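/- Let $X$ be a Coxeter graph, $(W,S)$ its Coxeter system (of arbitrary rank), with length $\ell$ and Bruhat order $\le$, and let $W_c$ be the set of fully commutative elements of $W$ (any two reduced words are related by commutations of adjacent commuting generators). For $x,w\in W$ put $[x,w]_c=\{y\in W_c: x\le y\le w\}$. Let $\mathcal A=\mathbb Z[q^{1/2},q^{-1/2}]$, let $\mathcal H$ be the Hecke algebra of $(W,S)$ over $\mathcal A$ with standard basis $\{T_w\}_{w\in W}$ (so that $T_s^2=(q-1)T_s+q$), let $P_{x,w}\in\mathbb Z[q]$ be the Kazhdan--Lusztig polynomials, $C'_w=q^{-\ell(w)/2}\sum_{x\le w}P_{x,w}(q)T_x$, and let $\mu(x,w)$ be the coefficient of $q^{(\ell(w)-\ell(x)-1)/2}$ in $P_{x,w}$ (zero if the exponent is not a non-negative integer). Let $TL=\mathcal H/J$ be the generalized Temperley--Lieb algebra, where $J$ is the two-sided ideal generated by the sums $\sum_{u\in\langle s,s'\rangle}T_u$ over all pairs of non-commuting $s,s'\in S$ such that $ss'$ has finite order; let $\sigma:\mathcal H\to TL$ be the projection and $t_w=\sigma(T_w)$. Let $\iota$ be the ring involution of $TL$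 with $\iota(q^{1/2})=q^{-1/2}$ and $\iota(t_w)=(t_{w^{-1}})^{-1}$. The polynomials $D_{x,w}\in\mathbb Z[q]$ ($x\in W_c$, $w\in W$) are determined by $t_w=\sum_{x\in W_c,\,x\le w}D_{x,w}(q)t_x$ and $D_{x,w}=0$ if $x\not\le w$. The polynomials $L_{x,w}(q^{-1/2})\in\mathbb Z[q^{-1/2}]$ ($x,w\in W_c$) are determined by: the elements $c_w=\sum_{x\in W_c,\,x\le w}q^{-\ell(x)/2}L_{x,w}(q^{-1/2})t_x$, $w\in W_c$, form an $\mathcal A$-basis of $TL$, $\iota(c_w)=c_w$, $L_{w,w}=1$, $L_{x,w}\in q^{-1/2}\mathbb Z[q^{-1/2}]$ if $x\neq w$, and $L_{x,w}=0$ if $x\not\le w$. Assume that $\sigma(C'_w)=c_w$ for $w\in W_c$ and $\sigma(C'_w)=0$ for $w\in W\setminus W_c$ (condition (Cw-0)). Theorem. Let $s\in S$ and let $x,w\in W_c$ be such that $sx\in W_c$ and $sw<w$. Then $$L_{x,w}(q^{-\frac12})=L_{sx,sw}(q^{-\frac12})+q^{c-\frac12}L_{x,sw}(q^{-\frac12})-\sum_{\substack{z\in[sx,sw]_c\\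 sz<z}}\mu(z,sw)\,L_{x,z}(q^{-\frac12})+q^{-\frac12}\sum_{\substack{z\in W_c,\ sz\notin W_c\\ x\le sz,\ z\le w}}q^{\frac{\ell(x)-\ell(z)}2}D_{x,sz}(q)\,L_{z,sw}(q^{-\frac12}),$$ where $c=1$ if $sx<x$ and $c=0$ otherwise. -/

import Mathlib

noncomputable section

namespace GenTL

open Polynomial

/-! ### Coxeter groups: Bruhat order and fully commutative elements -/

section Coxeter

variable {B W : Type*} [Group W] {M : CoxeterMatrix B} (cs : CoxeterSystem M W)

/-- One step up in the Bruhat graph: `v = u t` with `t` a reflection and `ℓ(u) < ℓ(v)`. -/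
def BruhatStep (u v : W) : Prop :=
  ∃ t : W, cs.IsReflection t ∧ v = u * t ∧ cs.length u < cs.length v

/-- The Bruhat order `u ≤ v`. All its lower intervals are finite sets. -/
def BruhatLE (u v : W) : Prop := Relation.ReflTransGen (BruhatStep cs) u v

/-- The strict Bruhat order `u < v`. -/
def BruhatLT (u v : W) : Prop := BruhatLE cs u v ∧ u ≠ v

/-- Swapping two adjacent letters of a word whose simple reflections commute. -/
inductive CommMove (M : CoxeterMatrix B) : List B → List B → Prop
  | swap (α β : List B) (i j : B) (h : M i j = 2) :
      CommMove M (α ++ i :: j :: β) (α ++ j :: i :: β)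

/-- `w` is fully commutative: any reduced word of `w` is obtained from any other one by
commutations of adjacent commuting generators. -/
def IsFC (w : W) : Prop :=
  ∀ ω ω' : List B, cs.IsReduced ω → cs.IsReduced ω' → cs.wordProd ω = w → cs.wordProd ω' = w →
    Relation.ReflTransGen (CommMove M) ω ω'

/-- The interval `[x, w]_c`: the fully commutative elements `y` with `x ≤ y ≤ w`. -/
def intervalFC (x w : W) : Set W := {y | IsFC cs y ∧ BruhatLE cs x y ∧ BruhatLE cs y w}

end Coxeter

/-! ### The Hecke algebra -/

/-- The ring `ℤ[q^{1/2}, q^{-1/2}]`. -/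
abbrev A : Type := LaurentPolynomial ℤ

/-- The power `q^{n/2}`. -/
def qh (n : ℤ) : A := LaurentPolynomial.T n

/-- The value `p(q)` of an integral polynomial. -/
def atq (p : ℤ[X]) : A := aeval (qh 2) p

/-- The value `p(q^{-1/2})` of an integral polynomial. -/
def atqh (p : ℤ[X]) : A := aeval (qh (-1)) p

section Hecke

variable {B : Type*}

/-- The defining relations of the Hecke algebra: `T_i² = (q - 1) T_i + q` and the braid relations
(the braid relation is void if `M i j = 0`, that is, if `s_i s_j` has infinite order). -/
inductive HeckeRel (M : CoxeterMatrix B) : FreeAlgebra A B → FreeAlgebra A B → Prop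
  | quadratic (i : B) :
      HeckeRel M (FreeAlgebra.ι A i * FreeAlgebra.ι A i)
        ((qh 2 - 1) • FreeAlgebra.ι A i + algebraMap A (FreeAlgebra A B) (qh 2))
  | braid (i j : B) :
      HeckeRel M (((CoxeterSystem.braidWord M i j).map (FreeAlgebra.ι A)).prod)
        (((CoxeterSystem.braidWord M j i).map (FreeAlgebra.ι A)).prod)

/-- The Hecke algebra of a Coxeter matrix. -/
abbrev Hecke (M : CoxeterMatrix B) : Type _ := RingQuot (HeckeRel M)

/-- The generator `T_i` of the Hecke algebra. -/
def heckeGen (M : CoxeterMatrix B) (i : B) : Hecke M :=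
  RingQuot.mkAlgHom A (HeckeRel M) (FreeAlgebra.ι A i)

variable {W : Type*} [Group W] {M : CoxeterMatrix B} (cs : CoxeterSystem M W)

/-- The element `T_w = T_{i_1} ⋯ T_{i_r}` of the Hecke algebra, where `i_1 ⋯ i_r` is a reduced
word of `w` (it does not depend on the choice of the word). -/
def Tw (w : W) : Hecke M := ((Classical.choose (cs.exists_isReduced w)).map (heckeGen M)).prod

/-- `ι` is the bar involution of an `A`-algebra `R` with respect to a family `t` indexed by `W`:
the ring endomorphism with `ι(q^{1/2}) = q^{-1/2}` and `ι(t_w) = (t_{w⁻¹})⁻¹`. -/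
def IsBar {R : Type*} [Ring R] [Algebra A R] (t : W → R) (ι : R →+* R) : Prop :=
  (∀ a : A, ι (algebraMap A R a) = algebraMap A R (LaurentPolynomial.invert a)) ∧
    ∀ w : W, ι (t w) * t w⁻¹ = 1 ∧ t w⁻¹ * ι (t w) = 1

/-- The element `q^{-ℓ(w)/2} ∑_{x ≤ w} P_{x,w}(q) T_x`. -/
def klElem (P : W → W → ℤ[X]) (w : W) : Hecke M :=
  qh (-(cs.length w : ℤ)) • ∑ᶠ x ∈ {x : W | BruhatLE cs x w}, atq (P x w) • Tw cs x

/-- `P` is the family of Kazhdan–Lusztig polynomials. -/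
def IsKLFamily (P : W → W → ℤ[X]) : Prop :=
  (∀ w, P w w = 1) ∧
  (∀ x w, ¬ BruhatLE cs x w → P x w = 0) ∧
  (∀ x w, BruhatLT cs x w → 2 * (P x w).natDegree + 1 ≤ cs.length w - cs.length x) ∧
  ∃ ι : Hecke M →+* Hecke M, IsBar (Tw cs) ι ∧ ∀ w, ι (klElem cs P w) = klElem cs P w

open Classical in
/-- The Kazhdan–Lusztig polynomials `P_{x,w}`. -/
def klPoly : W → W → ℤ[X] :=
  if h : ∃ P, IsKLFamily cs P then Classical.choose h else 0

/-- The Kazhdan–Lusztig basis element `C'_w`. -/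
def CPrime (w : W) : Hecke M := klElem cs (klPoly cs) w

/-- `μ(x,w)`, the coefficient of `q^{(ℓ(w)-ℓ(x)-1)/2}` in `P_{x,w}`; it is `0` if this exponent is
not a natural number. -/
def mu (x w : W) : ℤ :=
  if Odd (cs.length w - cs.length x) then
    (klPoly cs x w).coeff ((cs.length w - cs.length x - 1) / 2)
  else 0

open Classical in
/-- The number `c`, which is `1` if `s_i x < x` and `0` otherwise. -/
def descentIndicator (i : B) (x : W) : ℤ := if BruhatLT cs (cs.simple i * x) x then 1 else 0

end Hecke

/-! ### The generalized Temperley–Lieb algebra -/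

section TemperleyLieb

variable {B W : Type*} [Group W] {M : CoxeterMatrix B} (cs : CoxeterSystem M W)

/-- The two-sided ideal `J` generated by the sums of all `T_w`, `w` in the parabolic subgroup
`⟨s_i, s_j⟩`, for non-commuting `s_i`, `s_j` whose product has finite order. -/
def idealJ : TwoSidedIdeal (Hecke M) :=
  TwoSidedIdeal.span {h | ∃ i j : B, 3 ≤ M i j ∧
    h = ∑ᶠ w ∈ (Subgroup.closure {cs.simple i, cs.simple j} : Set W), Tw cs w}

/-- The generalized Temperley–Lieb algebra. -/
abbrev TL : Type _ := (idealJ cs).ringCon.Quotient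

/-- The canonical projection `σ` of the Hecke algebra onto the Temperley–Lieb algebra. -/
def proj : Hecke M →ₐ[A] TL cs := RingCon.mkₐ (α := A) (idealJ cs).ringCon

/-- `t_w = σ(T_w)`. -/
def tw (w : W) : TL cs := proj cs (Tw cs w)

/-- `D` is the family of polynomials that expresses every `t_w` through the `t_x`, `x` fully
commutative (extended by `0` to the `x` that are not fully commutative). -/
def IsDFamily (D : W → W → ℤ[X]) : Prop :=
  (∀ x w, ¬ (IsFC cs x ∧ BruhatLE cs x w) → D x w = 0) ∧
  (∀ w, IsFC cs w → D w w = 1) ∧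
  ∀ w, tw cs w = ∑ᶠ x ∈ {x : W | IsFC cs x ∧ BruhatLE cs x w}, atq (D x w) • tw cs x

open Classical in
/-- The polynomials `D_{x,w}`. -/
def dPoly : W → W → ℤ[X] :=
  if h : ∃ D, IsDFamily cs D then Classical.choose h else 0

/-- The element `∑_{x ≤ w, x fully commutative} q^{-ℓ(x)/2} L_{x,w}(q^{-1/2}) t_x`. -/
def icElem (L : W → W → ℤ[X]) (w : W) : TL cs :=
  ∑ᶠ x ∈ {x : W | IsFC cs x ∧ BruhatLE cs x w},
    (qh (-(cs.length x : ℤ)) * atqh (L x w)) • tw cs x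

/-- `L` is the family of polynomials (in `q^{-1/2}`) of the IC basis of the Temperley–Lieb algebra
(extended by `0` to the pairs of elements that are not both fully commutative). -/
def IsICFamily (L : W → W → ℤ[X]) : Prop :=
  (∀ x w, ¬ (IsFC cs x ∧ IsFC cs w ∧ BruhatLE cs x w) → L x w = 0) ∧
  (∀ w, IsFC cs w → L w w = 1) ∧
  (∀ x w, x ≠ w → (L x w).coeff 0 = 0) ∧
  (∃ ι : TL cs →+* TL cs, IsBar (tw cs) ι ∧
    ∀ w, IsFC cs w → ι (icElem cs L w) = icElem cs L w) ∧
  LinearIndependent A (fun w : {w : W // IsFC cs w} => icElem cs L w.1) ∧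
  Submodule.span A (Set.range fun w : {w : W // IsFC cs w} => icElem cs L w.1) = ⊤

open Classical in
/-- The polynomials `L_{x,w}`, with indeterminate `q^{-1/2}`. -/
def icPoly : W → W → ℤ[X] :=
  if h : ∃ L, IsICFamily cs L then Classical.choose h else 0

/-- The Laurent polynomial `L_{x,w}(q^{-1/2})`. -/
def Lval (x w : W) : A := atqh (icPoly cs x w)

/-- The IC basis element `c_w`. -/
def cw (w : W) : TL cs := icElem cs (icPoly cs) w

/-- The projection `σ` maps `C'_w` to `c_w` if `w` is fully commutative and to `0` otherwise. -/
def ProjectsKLToIC : Prop :=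
  ∀ w : W, (IsFC cs w → proj cs (CPrime cs w) = cw cs w) ∧
    (¬ IsFC cs w → proj cs (CPrime cs w) = 0)

end TemperleyLieb

end GenTL

end

/-! Put v = sw and c_s = σ(C'_s) = q^{-1/2}(t_s + 1). The formula is the coordinate at q^{-ℓ(x)/2}
t_x of the identity c_s c_v = c_w + ∑ μ(z,v) c_z, summed over z ≤ v with sz < z. On the left, t_s
t_z may produce t_{sz} with sz outside W_c; expanding it again in the t_x creates the sum with the
D_{x,sz} (`twCoord_proj_klGen_mul_cw`).

The identity holds because a bar-invariant element of TL whose normalized coordinates have only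
negative powers of q^{1/2} is zero (`eq_zero_of_bar_eq_self`). The difference `cwDefect` of the two
sides is visibly bar invariant, and its degree bound (`twCoord_cwDefect_mem_degLE`) rests on two
consequences of (Cw-0). From σ(C'_w) = 0 outside W_c, the normalized D_{x,w} with x ≠ w have only
negative powers (`dNorm_mem_degLE`). From σ(C'_w) = c_w on W_c, L_{x,w} is μ(x,w) q^{-1/2} plus
lower terms (`Lval_sub_mem_degLE`). So the constant term of q^{1/2} L_{x,v}, which occurs when sx <
x, is cancelled by the summand z = x.

The families P, D, L are picked by choice with default value 0, so their existence has to be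
established: P by the usual recursion (`isKLColumn_klStep`), D by induction on length from σ(C'_w) =
0, and L because σ(C'_1) = 1 is not 0. Computing with T_w needs Matsumoto's theorem
(`map_prod_eq_of_isReduced`), which in turn needs strong exchange and the fact that s_i s_j has
order exactly `M i j`. The lifting property `BruhatLE.simple_mul` adjusts the ranges of summation.
-/

namespace CoxeterSystem

open List

/-! ### The strong exchange condition -/

section StrongExchange

variable {B W : Type*} [Group W] {M : CoxeterMatrix B} (cs : CoxeterSystem M W)

open Classical in
/-- The action of a simple reflection on pairs of a group element and a sign. -/
noncomputable def signedConj (i : B) : Function.End (W × ZMod 2) :=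
  fun p => (cs.simple i * p.1 * cs.simple i, p.2 + if p.1 = cs.simple i then 1 else 0)

open Classical in
-- Letters act from right to left, and a letter flips the sign exactly when the current conjugate of
-- `p.1` equals it; conjugated back, this means that `p.1` is the corresponding entry of the right
-- inversion sequence.
theorem prod_signedConj_apply (ω : List B) (p : W × ZMod 2) :
    (ω.map cs.signedConj).prod p =
      (cs.wordProd ω * p.1 * (cs.wordProd ω)⁻¹, p.2 + ((cs.rightInvSeq ω).count p.1 : ℕ)) := by
  induction ω with
  | nil => simp; rfl
  | cons i ω ih =>
    rw [List.map_cons, List.prod_cons]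
    change cs.signedConj i ((ω.map cs.signedConj).prod p) = _
    rw [ih]
    have hcond : (cs.wordProd ω * p.1 * (cs.wordProd ω)⁻¹ = cs.simple i) ↔
        (cs.wordProd ω)⁻¹ * cs.simple i * cs.wordProd ω = p.1 := by
      constructor
      · intro h; rw [← h]; group
      · intro h; rw [← h]; group
    simp only [signedConj, rightInvSeq, wordProd_cons, List.count_cons, hcond, beq_iff_eq]
    simp only [mul_inv_rev,
      inv_simple, mul_assoc, Nat.cast_add, add_assoc, Nat.cast_ite, Nat.cast_one,
      Nat.cast_zero]

theorem wordProd_alternatingWord_two_mul (i j : B) (m : ℕ) :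
    cs.wordProd (alternatingWord i j (2 * m)) = (cs.simple i * cs.simple j) ^ m := by
  simp [prod_alternatingWord_eq_mul_pow]

theorem map_prod_alternatingWord_two_mul {N : Type*} [Monoid N] (f : B → N) (i j : B) (m : ℕ) :
    ((alternatingWord i j (2 * m)).map f).prod = (f i * f j) ^ m := by
  induction m with
  | zero => simp [alternatingWord]
  | succ m ih =>
    rw [show 2 * (m + 1) = 2 * m + 1 + 1 by ring, alternatingWord_succ', alternatingWord_succ']
    simp [ih, pow_succ', mul_assoc]

/-- Shifting the index by `M i j` inserts an `M i j`-th power of a product of the two generators,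
which is 1; hence the sequence is periodic. -/
theorem leftInvSeq_alternatingWord_eq_append (i j : B) :
    cs.leftInvSeq (alternatingWord i j (2 * M i j)) =
      (cs.leftInvSeq (alternatingWord i j (2 * M i j))).take (M i j) ++
        (cs.leftInvSeq (alternatingWord i j (2 * M i j))).take (M i j) := by
  apply List.ext_getElem
  · simp; omega
  · intro k h1 h2
    have hk : k < 2 * M i j := by simpa using h1
    rw [List.getElem_append]
    split_ifs with h
    · simp
    · have hlen : ((cs.leftInvSeq (alternatingWord i j (2 * M i j))).take (M i j)).length
          = M i j := by simp; omega
      have hk' : M i j ≤ k := by rw [hlen] at h; omega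
      rw [List.getElem_take, getElem_leftInvSeq_alternatingWord _ _ _ _ _ hk,
        getElem_leftInvSeq_alternatingWord _ _ _ _ _ (by rw [hlen]; omega)]
      obtain ⟨d, rfl⟩ := Nat.exists_eq_add_of_le hk'
      have : M i j + d - M i j = d := by omega
      simp only [hlen, this, prod_alternatingWord_eq_mul_pow]
      have e1 : (2 * (M i j + d) + 1) / 2 = M i j + d := by omega
      have e2 : (2 * d + 1) / 2 = d := by omega
      rw [e1, e2, pow_add, simple_mul_simple_pow', one_mul]
      simp

/-- By periodicity every element occurs an even number of times in the inversion sequence of the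
relator, so all signs cancel in `ZMod 2`. -/
theorem isLiftable_signedConj : M.IsLiftable cs.signedConj := by
  classical
  intro i j
  rw [← map_prod_alternatingWord_two_mul]
  funext p
  rw [prod_signedConj_apply, wordProd_alternatingWord_two_mul, simple_mul_simple_pow]
  have hrev : alternatingWord i j (2 * M i j) = (alternatingWord j i (2 * M j i)).reverse := by
    rw [M.symmetric j i]
    apply List.ext_getElem
    · simp
    · intro k h1 h2
      have hk : k < 2 * M i j := by simpa using h1
      rw [List.getElem_reverse, getElem_alternatingWord _ _ _ _ hk,
        getElem_alternatingWord _ _ _ _ (by simp; omega)]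
      simp only [length_alternatingWord]
      grind
  rw [hrev, rightInvSeq_reverse, List.count_reverse, leftInvSeq_alternatingWord_eq_append,
    List.count_append]
  have : ∀ a : ZMod 2, a + a = 0 := by decide
  change _ = p
  simp [this]

/-- The action of the group on pairs of a group element and a sign. -/
noncomputable def signedConjHom : W →* Function.End (W × ZMod 2) :=
  cs.lift ⟨cs.signedConj, cs.isLiftable_signedConj⟩

open Classical in
theorem signedConjHom_wordProd (ω : List B) (p : W × ZMod 2) :
    cs.signedConjHom (cs.wordProd ω) p =
      (cs.wordProd ω * p.1 * (cs.wordProd ω)⁻¹, p.2 + ((cs.rightInvSeq ω).count p.1 : ℕ)) := by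
  rw [← prod_signedConj_apply, wordProd, map_list_prod, List.map_map]
  have : ⇑cs.signedConjHom ∘ cs.simple = cs.signedConj := by
    funext i
    simp [signedConjHom]
  rw [this]

theorem signedConjHom_fst (w : W) (p : W × ZMod 2) :
    (cs.signedConjHom w p).1 = w * p.1 * w⁻¹ := by
  classical
  obtain ⟨ω, rfl⟩ := cs.wordProd_surjective w
  rw [signedConjHom_wordProd]

theorem signedConjHom_add (w t : W) (a b : ZMod 2) :
    (cs.signedConjHom w (t, a + b)).2 = (cs.signedConjHom w (t, a)).2 + b := by
  classical
  obtain ⟨ω, rfl⟩ := cs.wordProd_surjective w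
  simp only [signedConjHom_wordProd]
  ring

/-- For t = u s u⁻¹, the action of u⁻¹ carries t to s, the action of s flips the sign once, and u
undoes whatever u⁻¹ did to the sign. -/
theorem IsReflection.signedConjHom_self {t : W} (ht : cs.IsReflection t) (a : ZMod 2) :
    (cs.signedConjHom t (t, a)).2 = a + 1 := by
  classical
  obtain ⟨u, i, rfl⟩ := ht
  have key : ∀ x y : W, ∀ p, cs.signedConjHom (x * y) p =
      cs.signedConjHom x (cs.signedConjHom y p) := fun x y p => by
    rw [map_mul]; rfl
  set t := u * cs.simple i * u⁻¹ with ht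
  have h1 : (cs.signedConjHom u⁻¹ (t, a)) = (cs.simple i, (cs.signedConjHom u⁻¹ (t, a)).2) := by
    ext
    · rw [signedConjHom_fst, ht]; simp [mul_assoc]
    · rfl
  have h2 : ∀ b, cs.signedConjHom (cs.simple i) (cs.simple i, b) = (cs.simple i, b + 1) := by
    intro b
    simp [signedConjHom, signedConj]
  have h3 : cs.signedConjHom u (cs.signedConjHom u⁻¹ (t, a)) = (t, a) := by
    rw [← key]; simp; rfl
  conv_lhs => rw [ht, key, key, h1, h2, signedConjHom_add, ← h1, h3]

/-- The strong exchange condition. -/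
theorem mem_rightInvSeq_of_isRightInversion {ω : List B} {t : W}
    (h : cs.IsRightInversion (cs.wordProd ω) t) : t ∈ cs.rightInvSeq ω := by
  classical
  by_contra hmem
  obtain ⟨ht, hlt⟩ := h
  have key : ∀ x y : W, ∀ p, cs.signedConjHom (x * y) p =
      cs.signedConjHom x (cs.signedConjHom y p) := fun x y p => by
    rw [map_mul]; rfl
  -- If t is missing from the sequence, w fixes the sign at t, so wt flips it. Then t is an
  -- inversion of wt, contrary to ℓ(wt) < ℓ(w).
  have h0 : (cs.signedConjHom (cs.wordProd ω) (t, 1)).2 = 1 := by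
    rw [signedConjHom_wordProd]
    simp [List.count_eq_zero_of_not_mem hmem]
  obtain ⟨ω', hω', he⟩ := cs.exists_isReduced (cs.wordProd ω * t)
  have h1 : (cs.signedConjHom (cs.wordProd ω * t) (t, 0)).2 = 1 := by
    rw [key]
    have : cs.signedConjHom t (t, 0) = (t, 1) := by
      ext
      · rw [signedConjHom_fst]; simp
      · rw [ht.signedConjHom_self]; simp
    rw [this, h0]
  have hmem' : t ∈ cs.rightInvSeq ω' := by
    by_contra hm
    rw [he, signedConjHom_wordProd] at h1
    simp [List.count_eq_zero_of_not_mem hm] at h1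
  have := (cs.isRightInversion_of_mem_rightInvSeq hω' hmem').2
  rw [← he, mul_assoc, ht.mul_self, mul_one] at this
  omega

theorem exists_eraseIdx_of_isRightInversion {ω : List B} {t : W}
    (h : cs.IsRightInversion (cs.wordProd ω) t) :
    ∃ k < ω.length, cs.wordProd ω * t = cs.wordProd (ω.eraseIdx k) := by
  obtain ⟨k, hk, hkt⟩ := List.getElem_of_mem (cs.mem_rightInvSeq_of_isRightInversion h)
  refine ⟨k, by simpa using hk, ?_⟩
  rw [← wordProd_mul_getD_rightInvSeq, List.getD_eq_getElem _ _ hk, hkt]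

end StrongExchange

/-! ### The order of a product of two simple reflections -/

section Order

variable {B W : Type*} [Group W] {M : CoxeterMatrix B} (cs : CoxeterSystem M W)

open Module Polynomial.Chebyshev

/-- The coroot functionals of the geometric representation. -/
noncomputable def coroot (M : CoxeterMatrix B) (i : B) : Dual ℝ (B →₀ ℝ) :=
  -- Infinite order is encoded by `M i j = 0`; then π / 0 = 0 yields the value -2, as it should be.
  Finsupp.lsum ℝ fun j => (-2 * Real.cos (Real.pi / M i j)) • LinearMap.id

theorem coroot_single (M : CoxeterMatrix B) (i j : B) :
    coroot M i (Finsupp.single j 1) = -2 * Real.cos (Real.pi / M i j) := by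
  simp [coroot]

theorem coroot_single_self (M : CoxeterMatrix B) (i : B) :
    coroot M i (Finsupp.single i 1) = 2 := by
  simp [coroot_single]

/-- The reflection by which a generator acts in the geometric representation. -/
noncomputable def rootReflection (M : CoxeterMatrix B) (i : B) : (B →₀ ℝ) ≃ₗ[ℝ] (B →₀ ℝ) :=
  reflection (coroot_single_self M i)

theorem coroot_mul_coroot_sub_two (M : CoxeterMatrix B) (i j : B) :
    coroot M i (Finsupp.single j 1) * coroot M j (Finsupp.single i 1) - 2 =
      2 * Real.cos (2 * Real.pi / M i j) := by
  rw [coroot_single, coroot_single, M.symmetric j i, mul_div_assoc, Real.cos_two_mul]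
  ring

theorem sin_two_pi_div_ne_zero {m : ℕ} (hm : 3 ≤ m) : Real.sin (2 * Real.pi / m) ≠ 0 := by
  have hm' : (3 : ℝ) ≤ m := by exact_mod_cast hm
  apply ne_of_gt
  apply Real.sin_pos_of_pos_of_lt_pi
  · positivity
  · rw [div_lt_iff₀ (by linarith)]
    nlinarith [Real.pi_pos]

/-- S_a(2 cos θ) sin θ = sin((a+1)θ), and for θ = 2π/m the angles (a+1)θ and (b+1)θ add up to 2π. -/
theorem eval_S_add_eval_S_eq_zero {m : ℕ} (hm : 3 ≤ m) {a b : ℤ} (hab : a + b + 2 = m) :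
    (S ℝ a).eval (2 * Real.cos (2 * Real.pi / m)) +
      (S ℝ b).eval (2 * Real.cos (2 * Real.pi / m)) = 0 := by
  have hm' : (m : ℝ) ≠ 0 := by positivity
  have hs := sin_two_pi_div_ne_zero hm
  apply mul_right_cancel₀ hs
  rw [zero_mul, add_mul, S_two_mul_real_cos, S_two_mul_real_cos]
  have hb : (b : ℝ) + 1 = m - (a + 1) := by
    have : (a : ℝ) + b + 2 = m := by exact_mod_cast hab
    linarith
  rw [hb, sub_mul, mul_div_cancel₀ _ hm', Real.sin_two_pi_sub]
  ring

theorem isLiftable_rootReflection (M : CoxeterMatrix B) : M.IsLiftable (rootReflection M) := by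
  intro i j
  rcases Nat.lt_or_ge (M i j) 3 with h | h
  · interval_cases hm : M i j
    · simp
    · have : i = j := by
        by_contra hij
        exact M.off_diagonal i j hij hm
      subst this
      rw [pow_one]
      ext1 x
      exact involutive_reflection (coroot_single_self M i) x
    · have h1 : coroot M i (Finsupp.single j 1) = 0 := by
        rw [coroot_single, hm]; simp
      have h2 : coroot M j (Finsupp.single i 1) = 0 := by
        rw [coroot_single, M.symmetric, hm]; simp
      ext1 x
      rw [pow_two]
      simp only [rootReflection, LinearEquiv.mul_apply, reflection_apply, map_sub, map_smul, h1, h2,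
        coroot_single_self, LinearEquiv.coe_one, id]
      module
  · have hS := @eval_S_add_eval_S_eq_zero _ h
    have key : ∀ a b : ℤ, a + b + 2 = M i j → (S ℝ a).eval (2 * Real.cos (2 * Real.pi / M i j)) *
      ((S ℝ a).eval (2 * Real.cos (2 * Real.pi / M i j)) +
        (S ℝ b).eval (2 * Real.cos (2 * Real.pi / M i j))) = 0 := fun a b hab => by
      rw [hS hab, mul_zero]
    apply LinearEquiv.toLinearMap_injective
    rw [rootReflection, rootReflection, reflection_mul_reflection_pow _ _ _ _
      (coroot_mul_coroot_sub_two M i j).symm]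
    -- In the closed form of the power, every correction term has a vanishing Chebyshev factor:
    -- S_{k-1} = 0 if m = 2k, and S_k + S_{k-1} = 0 if m = 2k + 1.
    obtain ⟨k, hk | hk⟩ := Nat.even_or_odd' (M i j)
    · have h0 : (S ℝ ((k : ℤ) - 1)).eval (2 * Real.cos (2 * Real.pi / M i j)) = 0 := by
        have := @hS (k - 1) (k - 1) (by rw [hk]; push_cast; ring)
        linarith
      have e1 : ((M i j : ℤ) - 2) / 2 = k - 1 := by omega
      have e2 : ((M i j : ℤ) - 1) / 2 = k - 1 := by omega
      rw [e1, e2, h0]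
      simp
    · have e1 : ((M i j : ℤ) - 2) / 2 = k - 1 := by omega
      have e2 : ((M i j : ℤ) - 1) / 2 = k := by omega
      have e3 : ((M i j : ℤ) - 3) / 2 = k - 1 := by omega
      have e4 : (M i j : ℤ) / 2 = k := by omega
      have h0 := @hS k (k - 1) (by rw [hk]; push_cast; ring)
      rw [e1, e2, e3, e4, h0]
      simp

/-- The geometric representation. -/
noncomputable def geometricRep : W →* ((B →₀ ℝ) ≃ₗ[ℝ] (B →₀ ℝ)) :=
  cs.lift ⟨rootReflection M, isLiftable_rootReflection M⟩

/-- The power fixes the simple root e_i. With θ = 2π / `M i j`, its j-coordinate gives sin(nθ) = 0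
and its i-coordinate then gives cos(nθ) = 1. For `M i j` < 3 the division by sin θ fails, and
explicit values of S at ±2 are used instead. -/
theorem dvd_of_simple_mul_simple_pow_eq_one {i j : B} (hij : i ≠ j) {n : ℕ}
    (h : (cs.simple i * cs.simple j) ^ n = 1) : M i j ∣ n := by
  have h1 : (rootReflection M i * rootReflection M j) ^ n = 1 := by
    have := congrArg cs.geometricRep h
    simpa [geometricRep] using this
  have h2 := congrArg (fun f => f (Finsupp.single i 1)) h1
  simp only [rootReflection, LinearEquiv.coe_one, id] at h2
  rw [reflection_mul_reflection_pow_apply_self _ _ _ _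
      (coroot_mul_coroot_sub_two M i j).symm] at h2
  set t := 2 * Real.cos (2 * Real.pi / M i j) with ht
  have hi := DFunLike.congr_fun h2 i
  have hj := DFunLike.congr_fun h2 j
  simp [hij, hij.symm] at hi hj
  rcases Nat.lt_or_ge (M i j) 3 with h | h
  · interval_cases hm : M i j
    · simp [coroot_single, M.symmetric j i, hm] at hj
      rw [show t = 2 by simp [ht], S_eval_two] at hj
      simp at hj
      simp [hj]
    · exact absurd hm (M.off_diagonal i j hij)
    · rw [show t = -2 by simp [ht], S_eval_neg_two, S_eval_neg_two] at hi
      rcases Nat.even_or_odd n with he | ho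
      · exact he.two_dvd
      · exfalso
        have o1 : Odd (n : ℤ) := by exact_mod_cast ho
        have o2 : Even ((n : ℤ) - 1) := by grind
        simp [Int.negOnePow_odd _ o1, Int.negOnePow_even _ o2] at hi
        linarith
  · have hs := sin_two_pi_div_ne_zero h
    have hm' : (3 : ℝ) ≤ M i j := by exact_mod_cast h
    have hcos : Real.cos (Real.pi / M i j) ≠ 0 := by
      apply ne_of_gt
      apply Real.cos_pos_of_mem_Ioo
      constructor
      · have : 0 < Real.pi / M i j := by positivity
        linarith [Real.pi_pos]
      · rw [div_lt_iff₀ (by linarith)]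
        nlinarith [Real.pi_pos]
    have hj' : (S ℝ ((n : ℤ) - 1)).eval t = 0 := by
      rcases hj with hj | hj
      · exact hj
      · rw [coroot_single, M.symmetric j i] at hj
        simp [hcos] at hj
    rw [hj', add_zero] at hi
    have e1 := S_two_mul_real_cos (2 * Real.pi / M i j) (n - 1)
    have e2 := S_two_mul_real_cos (2 * Real.pi / M i j) n
    rw [← ht, hj', zero_mul] at e1
    rw [← ht, hi, one_mul] at e2
    push_cast at e1 e2
    rw [sub_add_cancel] at e1
    rw [add_mul, one_mul, Real.sin_add, ← e1, zero_mul, zero_add] at e2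
    have hc : Real.cos (n * (2 * Real.pi / M i j)) = 1 := by
      apply mul_right_cancel₀ hs
      rw [one_mul, ← e2]
    obtain ⟨k, hk⟩ := (Real.cos_eq_one_iff _).1 hc
    have : (n : ℝ) = k * M i j := by
      have hp := Real.pi_pos
      field_simp at hk
      linarith
    have : (n : ℤ) = k * M i j := by exact_mod_cast this
    exact_mod_cast Dvd.intro_left k this.symm

end Order

/-! ### Matsumoto's theorem -/

section Matsumoto

variable {B W : Type*} [Group W] {M : CoxeterMatrix B} (cs : CoxeterSystem M W)

theorem isReduced_of_wordProd_eq {ω ω' : List B} (h : cs.IsReduced ω)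
    (hp : cs.wordProd ω' = cs.wordProd ω) (hl : ω'.length = ω.length) : cs.IsReduced ω' := by
  unfold IsReduced at *
  rw [hp, h, hl]

theorem isReduced_of_cons {i : B} {ω : List B} (h : cs.IsReduced (i :: ω)) : cs.IsReduced ω := by
  simpa using h.drop 1

theorem isReduced_of_concat {i : B} {ω : List B} (h : cs.IsReduced (ω ++ [i])) :
    cs.IsReduced ω := by
  simpa using h.take ω.length

/-- The equality makes (s_i s_j)^n trivial, so `M i j` divides n; reducedness bounds n by `M i j`.
-/
theorem eq_coxeterMatrix_of_wordProd_alternatingWord_eq {i j : B} (hij : i ≠ j) {n : ℕ}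
    (hn : 0 < n) (hr : cs.IsReduced (alternatingWord i j n))
    (h : cs.wordProd (alternatingWord i j n) = cs.wordProd (alternatingWord j i n)) :
    n = M i j := by
  have h1 : (cs.simple i * cs.simple j) ^ n = 1 := by
    rw [← wordProd_alternatingWord_two_mul, two_mul]
    have : alternatingWord i j (n + n) = (if Even n then alternatingWord i j n
        else alternatingWord j i n) ++ alternatingWord i j n := by
      have h1 := listTake_alternatingWord i j n n (by omega)
      rw [← h1, two_mul]
      apply List.ext_getElem
      · simp
      · intro k h1 h2
        have hk : k < n + n := by simpa using h1
        rw [List.getElem_append, getElem_alternatingWord _ _ _ _ hk]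
        split_ifs with h3 h4 h4 <;>
          simp only [length_take, length_alternatingWord] at h4
        · rw [getElem_take, getElem_alternatingWord _ _ _ _ hk, if_pos h3]
        · rw [getElem_alternatingWord _ _ _ _ (by simp; omega), if_pos]
          simp only [length_take, length_alternatingWord]
          grind
        · rw [getElem_take, getElem_alternatingWord _ _ _ _ hk, if_neg h3]
        · rw [getElem_alternatingWord _ _ _ _ (by simp; omega), if_neg]
          simp only [length_take, length_alternatingWord]
          grind
    rw [this, wordProd_append]
    have hsq : ∀ m, cs.wordProd (if Even m then alternatingWord j i m else alternatingWord i j m) *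
        cs.wordProd (alternatingWord i j m) = 1 := by
      intro m
      induction m with
      | zero => simp [alternatingWord]
      | succ m ih =>
        conv_lhs => arg 2; rw [alternatingWord_succ']
        by_cases hm : Even m
        · simp only [Nat.even_add_one, hm, not_true, if_false, if_true] at ih ⊢
          rw [alternatingWord_succ, wordProd_concat, wordProd_cons]
          simpa [mul_assoc] using ih
        · simp only [Nat.even_add_one, hm, not_false_iff, if_false, if_true] at ih ⊢
          rw [alternatingWord_succ, wordProd_concat, wordProd_cons]
          simpa [mul_assoc] using ih
    rw [← hsq n]
    congr 1
    split_ifs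
    · exact h
    · exact h.symm
  have h2 := cs.dvd_of_simple_mul_simple_pow_eq_one hij h1
  have h3 : M i j ≠ 0 := by
    intro h0
    rw [h0, Nat.zero_dvd] at h2
    omega
  have h4 : n ≤ M i j := by
    by_contra h4
    exact cs.not_isReduced_alternatingWord i j h3 (by omega) hr
  exact le_antisymm h4 (Nat.le_of_dvd hn h2)

/-- If the last letter of one reduced word of an element is appended to another one, then a letter
of the latter can be deleted. -/
theorem exists_eraseIdx_of_reduced {ω v : List B} {a : B} (hω' : cs.IsReduced (v ++ [a]))
    (hp : cs.wordProd ω = cs.wordProd (v ++ [a])) :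
    ∃ k < ω.length, cs.wordProd (ω.eraseIdx k ++ [a]) = cs.wordProd ω := by
  have hinv : cs.IsRightInversion (cs.wordProd ω) (cs.simple a) := by
    refine ⟨cs.isReflection_simple a, ?_⟩
    rw [hp, hω'.eq, ← concat_eq_append, wordProd_concat]
    simp only [simple_mul_simple_cancel_right, concat_eq_append, length_append, length_singleton]
    exact Nat.lt_succ_of_le (cs.length_wordProd_le v)
  obtain ⟨k, hk, he⟩ := cs.exists_eraseIdx_of_isRightInversion hinv
  refine ⟨k, hk, ?_⟩
  rw [← concat_eq_append, wordProd_concat, ← he]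
  simp

/-- **Matsumoto's theorem**: a map from the generators to a monoid that satisfies the braid
relations takes the same product on any two reduced words of the same element. -/
theorem map_prod_eq_of_isReduced {N : Type*} [Monoid N] (f : B → N)
    (hf : ∀ i j, ((braidWord M i j).map f).prod = ((braidWord M j i).map f).prod)
    {ω ω' : List B} (hω : cs.IsReduced ω) (hω' : cs.IsReduced ω')
    (h : cs.wordProd ω = cs.wordProd ω') : (ω.map f).prod = (ω'.map f).prod := by
  induction hn : ω.length generalizing ω ω' with
  | zero =>
    have h2 : ω'.length = 0 := by rw [← hω'.eq, ← h, hω.eq, hn]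
    rw [List.length_eq_zero_iff] at hn h2
    rw [hn, h2]
  | succ n ih =>
    have hlen : ∀ {ω ω'}, cs.IsReduced ω → cs.IsReduced ω' → cs.wordProd ω = cs.wordProd ω' →
        ω.length = ω'.length := fun h1 h2 h3 => by rw [← h1.eq, ← h2.eq, h3]
    -- By induction, reduced words of the same element that share their first letter, or their last
    -- one, already have the same product under `f`.
    have first : ∀ (i : B) (u v : List B), cs.IsReduced (i :: u) → cs.IsReduced (i :: v) →
        cs.wordProd (i :: u) = cs.wordProd (i :: v) → (i :: u).length = n + 1 →
        ((i :: u).map f).prod = ((i :: v).map f).prod := by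
      intro i u v hu hv he hl
      rw [wordProd_cons, wordProd_cons] at he
      simp only [map_cons, prod_cons]
      rw [ih (cs.isReduced_of_cons hu) (cs.isReduced_of_cons hv) (mul_left_cancel he)
        (by simpa using hl)]
    have last : ∀ (i : B) (u v : List B), cs.IsReduced (u ++ [i]) → cs.IsReduced (v ++ [i]) →
        cs.wordProd (u ++ [i]) = cs.wordProd (v ++ [i]) → (u ++ [i]).length = n + 1 →
        ((u ++ [i]).map f).prod = ((v ++ [i]).map f).prod := by
      intro i u v hu hv he hl
      rw [wordProd_append, wordProd_append] at he
      simp only [map_append, prod_append]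
      rw [ih (cs.isReduced_of_concat hu) (cs.isReduced_of_concat hv) (mul_right_cancel he)
        (by simpa using hl)]
    -- Exchange appends `a` and deletes a letter of `x :: u`. Were this not `x`, the new word would
    -- share its first letter with one word and its last letter with the other, forcing equal
    -- products.
    have step : ∀ (x : B) (u v : List B) (a : B), cs.IsReduced (x :: u) →
        cs.IsReduced (v ++ [a]) → cs.wordProd (x :: u) = cs.wordProd (v ++ [a]) →
        (x :: u).length = n + 1 → ((x :: u).map f).prod ≠ ((v ++ [a]).map f).prod →
        cs.IsReduced (u ++ [a]) ∧ cs.wordProd (u ++ [a]) = cs.wordProd (x :: u) ∧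
          ((u ++ [a]).map f).prod ≠ ((x :: u).map f).prod := by
      intro x u v a h1 h2 h3 h4 h5
      obtain ⟨k, hk, he⟩ := cs.exists_eraseIdx_of_reduced h2 h3
      have hr : cs.IsReduced ((x :: u).eraseIdx k ++ [a]) := by
        refine cs.isReduced_of_wordProd_eq h1 he ?_
        rw [length_append, length_eraseIdx_of_lt hk]
        simp only [length_singleton]
        omega
      have hlast : (((x :: u).eraseIdx k ++ [a]).map f).prod = ((v ++ [a]).map f).prod :=
        last a _ _ hr h2 (he.trans h3) (by rw [hlen hr h1 he, h4])
      rcases k with _ | k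
      · simp only [eraseIdx_cons_zero] at hr he hlast
        exact ⟨hr, he, fun h => h5 (h.symm.trans hlast)⟩
      · exfalso
        rw [eraseIdx_cons_succ, cons_append] at hr he hlast
        exact h5 ((first x _ _ hr h1 he (by rw [hlen hr h1 he, h4])).symm.trans hlast)
    by_contra hne
    have hne0 : ∀ {ω ω' : List B}, (ω.map f).prod ≠ (ω'.map f).prod → ω ≠ ω' :=
      fun h h' => h (by rw [h'])
    -- Repeating the exchange with the roles of the two words swapped builds an ever longer
    -- alternating suffix. At full length, one more exchange yields the other alternating word, and
    -- the two are the sides of a braid relation.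
    have iter : ∀ k, k ≤ n → ∃ (i j : B) (u v : List B), i ≠ j ∧
        cs.IsReduced (u ++ alternatingWord i j (k + 1)) ∧ cs.IsReduced (v ++ [i]) ∧
        cs.wordProd (u ++ alternatingWord i j (k + 1)) = cs.wordProd (v ++ [i]) ∧
        (u ++ alternatingWord i j (k + 1)).length = n + 1 ∧
        ((u ++ alternatingWord i j (k + 1)).map f).prod ≠ ((v ++ [i]).map f).prod := by
      intro k
      induction k with
      | zero =>
        intro _
        have hω0 : ω ≠ [] := by rintro rfl; simp at hn
        have hω0' : ω' ≠ [] := by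
          rintro rfl
          have := hlen hω hω' h
          rw [hn] at this
          simp at this
        obtain ⟨u, j, rfl⟩ : ∃ u j, ω = u ++ [j] :=
          ⟨_, _, (List.dropLast_append_getLast hω0).symm⟩
        obtain ⟨v, i, rfl⟩ : ∃ u j, ω' = u ++ [j] :=
          ⟨_, _, (List.dropLast_append_getLast hω0').symm⟩
        refine ⟨i, j, u, v, ?_, ?_⟩
        · rintro rfl
          exact hne (last i u v hω hω' h hn)
        · simpa [alternatingWord] using ⟨hω, hω', h, by simpa using hn, by simpa using hne⟩
      | succ k ihk =>
        intro hk
        obtain ⟨i, j, u, v, hij, h1, h2, h3, h4, h5⟩ := ihk (by omega)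
        rcases u with _ | ⟨x, u⟩
        · simp at h4
          omega
        · rw [cons_append] at h1 h3 h4 h5
          obtain ⟨g1, g2, g3⟩ := step x _ v i h1 h2 h3 h4 h5
          refine ⟨j, i, u, x :: (u ++ alternatingWord j i k), hij.symm, ?_⟩
          have e1 : u ++ alternatingWord j i (k + 1 + 1) =
              (u ++ alternatingWord i j (k + 1)) ++ [i] := by
            rw [alternatingWord_succ j i (k + 1)]
            simp
          have e2 : x :: (u ++ alternatingWord j i k) ++ [j] =
              x :: (u ++ alternatingWord i j (k + 1)) := by
            rw [alternatingWord_succ i j k]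
            simp
          rw [e1, e2]
          exact ⟨g1, h1, g2, (hlen g1 h1 g2).trans h4, g3⟩
    obtain ⟨i, j, u, v, hij, h1, h2, h3, h4, h5⟩ := iter n le_rfl
    have hu : u = [] := by simpa using h4
    subst hu
    rw [nil_append] at h1 h3 h4 h5
    rw [alternatingWord_succ'] at h1 h3 h4 h5
    obtain ⟨g1, g2, g3⟩ := step _ _ v i h1 h2 h3 h4 h5
    rw [← alternatingWord_succ'] at g2 g3 h1
    have e : alternatingWord i j n ++ [i] = alternatingWord j i (n + 1) := by
      rw [alternatingWord_succ]; simp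
    rw [e] at g1 g2 g3
    have hM := cs.eq_coxeterMatrix_of_wordProd_alternatingWord_eq hij (Nat.succ_pos n) h1 g2.symm
    have hb := hf i j
    rw [braidWord, braidWord, M.symmetric j i, ← hM] at hb
    exact g3 hb.symm

end Matsumoto

end CoxeterSystem

namespace GenTL

open CoxeterSystem

/-! ### The Bruhat order -/

section Bruhat

variable {B W : Type*} [Group W] {M : CoxeterMatrix B} {cs : CoxeterSystem M W}

theorem BruhatLE.refl (x : W) : BruhatLE cs x x := Relation.ReflTransGen.refl

theorem BruhatLE.trans {x y z : W} (h : BruhatLE cs x y) (h' : BruhatLE cs y z) :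
    BruhatLE cs x z := Relation.ReflTransGen.trans h h'

theorem BruhatLE.eq_or_length_lt {x y : W} (h : BruhatLE cs x y) :
    x = y ∨ cs.length x < cs.length y := by
  induction h with
  | refl => exact Or.inl rfl
  | tail _ h ih =>
    obtain ⟨t, -, -, hl⟩ := h
    rcases ih with rfl | h'
    · exact Or.inr hl
    · exact Or.inr (h'.trans hl)

theorem BruhatLE.length_le {x y : W} (h : BruhatLE cs x y) : cs.length x ≤ cs.length y := by
  rcases h.eq_or_length_lt with rfl | h
  · exact le_rfl
  · exact h.le

theorem BruhatLE.length_lt {x y : W} (h : BruhatLE cs x y) (hne : x ≠ y) :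
    cs.length x < cs.length y :=
  h.eq_or_length_lt.resolve_left hne

theorem bruhatLE_simple_mul {i : B} {x : W} (h : cs.length x < cs.length (cs.simple i * x)) :
    BruhatLE cs x (cs.simple i * x) := by
  refine Relation.ReflTransGen.single ⟨x⁻¹ * cs.simple i * x, ⟨x⁻¹, i, by simp⟩, ?_, h⟩
  group

theorem simple_mul_bruhatLE {i : B} {x : W} (h : cs.length (cs.simple i * x) < cs.length x) :
    BruhatLE cs (cs.simple i * x) x := by
  have := bruhatLE_simple_mul (cs := cs) (i := i) (x := cs.simple i * x) (by simpa using h)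
  simpa using this

theorem bruhatLT_simple_mul_iff {i : B} {x : W} :
    BruhatLT cs (cs.simple i * x) x ↔ cs.length (cs.simple i * x) < cs.length x :=
  ⟨fun h => h.1.length_lt h.2, fun h => ⟨simple_mul_bruhatLE h, fun he => by rw [he] at h; omega⟩⟩

/-- By strong exchange, each such x arises by deleting one letter of a fixed reduced word of w. -/
theorem finite_setOf_bruhatStep (w : W) : {x : W | BruhatStep cs x w}.Finite := by
  obtain ⟨ω, hω, rfl⟩ := cs.exists_isReduced w
  refine ((Set.finite_Iio ω.length).image fun k => cs.wordProd (ω.eraseIdx k)).subset ?_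
  rintro x ⟨t, ht, he, hl⟩
  have hx : cs.wordProd ω * t = x := by rw [he, mul_assoc, ht.mul_self, mul_one]
  obtain ⟨k, hk, hk'⟩ := cs.exists_eraseIdx_of_isRightInversion (ω := ω) (t := t)
    ⟨ht, by rw [hx]; exact hl⟩
  exact ⟨k, hk, by rw [← hx, hk']⟩

/-- Lower intervals of the Bruhat order are finite. -/
theorem finite_setOf_bruhatLE (w : W) : {x : W | BruhatLE cs x w}.Finite := by
  induction hn : cs.length w using Nat.strong_induction_on generalizing w with
  | _ n ih =>
    have : {x : W | BruhatLE cs x w} ⊆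
        {w} ∪ ⋃ y ∈ {y : W | BruhatStep cs y w}, {x | BruhatLE cs x y} := by
      intro x hx
      rcases Relation.ReflTransGen.cases_tail hx with h | ⟨y, hxy, hy⟩
      · exact Or.inl h.symm
      · exact Or.inr (Set.mem_biUnion hy hxy)
    refine Set.Finite.subset ((Set.finite_singleton w).union
      ((finite_setOf_bruhatStep w).biUnion fun y hy => ?_)) this
    obtain ⟨t, -, -, hl⟩ := id hy
    exact ih _ (hn ▸ hl) y rfl

/-- If multiplication by s reverses the inequality of lengths, z has a reduced word that starts with
s, and x arises from it by deleting a letter. Deleting s gives sx = z; deleting any other letter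
would make sx too short. -/
theorem BruhatStep.simple_mul {i : B} {x z : W} (h : BruhatStep cs x z) :
    cs.simple i * x = z ∨ BruhatStep cs (cs.simple i * x) (cs.simple i * z) := by
  obtain ⟨t, ht, rfl, hl⟩ := h
  by_cases hl' : cs.length (cs.simple i * x) < cs.length (cs.simple i * (x * t))
  · exact Or.inr ⟨t, ht, by rw [mul_assoc], hl'⟩
  · left
    have hx := cs.length_simple_mul x i
    have hz := cs.length_simple_mul (x * t) i
    have hne : cs.length (cs.simple i * (x * t)) ≠ cs.length (cs.simple i * x) := by
      rw [← mul_assoc]; exact ht.length_mul_left_ne _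
    have h1 : cs.length (cs.simple i * x) = cs.length x + 1 := by omega
    have h2 : cs.length (cs.simple i * (x * t)) + 1 = cs.length (x * t) := by omega
    obtain ⟨ω, hω, he⟩ := cs.exists_isReduced (cs.simple i * (x * t))
    have hw : x * t = cs.wordProd (i :: ω) := by rw [wordProd_cons, ← he]; simp
    obtain ⟨k, hk, hk'⟩ := cs.exists_eraseIdx_of_isRightInversion (ω := i :: ω) (t := t)
      ⟨ht, by rw [← hw, mul_assoc, ht.mul_self, mul_one]; exact hl⟩
    rw [← hw, mul_assoc, ht.mul_self, mul_one] at hk'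
    rcases k with _ | k
    · rw [List.eraseIdx_cons_zero, ← he] at hk'
      conv_lhs => rw [hk']
      simp
    · exfalso
      rw [List.eraseIdx_cons_succ, wordProd_cons] at hk'
      have hk2 : cs.simple i * x = cs.wordProd (ω.eraseIdx k) := by rw [hk']; simp
      have hk3 : k < ω.length := by simpa using hk
      have h3 := cs.length_wordProd_le (ω.eraseIdx k)
      rw [List.length_eraseIdx_of_lt hk3, ← hk2] at h3
      rw [he, hω.eq] at h2
      omega

/-- The lifting property of the Bruhat order. -/
theorem BruhatLE.simple_mul {x z : W} (h : BruhatLE cs x z) (i : B) :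
    BruhatLE cs (cs.simple i * x) z ∨ BruhatLE cs (cs.simple i * x) (cs.simple i * z) := by
  induction h with
  | refl => exact Or.inr (.refl _)
  | tail _ hs ih =>
    rcases ih with h1 | h1
    · exact Or.inl (h1.tail hs)
    · rcases hs.simple_mul (i := i) with h2 | h2
      · rw [h2] at h1
        exact Or.inl h1
      · exact Or.inr (h1.tail h2)

theorem BruhatLE.simple_mul_left {x z : W} (h : BruhatLE cs x z) {i : B}
    (hz : cs.length (cs.simple i * z) < cs.length z) : BruhatLE cs (cs.simple i * x) z :=
  (h.simple_mul i).elim id fun h' => h'.trans (simple_mul_bruhatLE hz)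

end Bruhat

/-! ### Fully commutative elements -/

section FullyCommutative

variable {B W : Type*} [Group W] {M : CoxeterMatrix B} {cs : CoxeterSystem M W}

open Classical in
-- The swapped letters are distinct. Erasing the first k leaves the swap in place, unless it removes
-- one of them, and then the two words coincide.
theorem CommMove.erase {α β : List B} (h : CommMove M α β) (k : B) :
    Relation.ReflTransGen (CommMove M) (α.erase k) (β.erase k) := by
  obtain ⟨α, β, i, j, hij⟩ := h
  have hne : i ≠ j := by
    rintro rfl
    rw [M.diagonal] at hij
    omega
  by_cases hk : k ∈ α
  · rw [List.erase_append_left _ hk, List.erase_append_left _ hk]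
    exact .single (.swap _ _ _ _ hij)
  · rw [List.erase_append_right _ hk, List.erase_append_right _ hk]
    by_cases hi : i = k
    · subst hi
      simp [hne.symm]
      exact .refl
    · by_cases hj : j = k
      · subst hj
        simp [hi]
        exact .refl
      · simp only [List.erase_cons, beq_iff_eq, hi, hj, if_false]
        exact .single (.swap _ _ _ _ hij)

/-- Prefixing `i` turns reduced words of sw into reduced words of w; a chain of commutations between
these survives erasing the first `i` from each word. -/
theorem IsFC.simple_mul {i : B} {w : W} (hw : IsFC cs w)
    (h : cs.length (cs.simple i * w) < cs.length w) : IsFC cs (cs.simple i * w) := by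
  classical
  intro ω ω' hω hω' he he'
  have key : ∀ ω, cs.IsReduced ω → cs.wordProd ω = cs.simple i * w →
      cs.IsReduced (i :: ω) ∧ cs.wordProd (i :: ω) = w := by
    intro ω hω he
    have hp : cs.wordProd (i :: ω) = w := by rw [wordProd_cons, he]; simp
    refine ⟨?_, hp⟩
    have := cs.length_simple_mul w i
    unfold CoxeterSystem.IsReduced at *
    rw [he] at hω
    rw [hp, List.length_cons]
    omega
  have h1 := hw _ _ (key ω hω he).1 (key ω' hω' he').1 (key ω hω he).2 (key ω' hω' he').2
  have h2 : Relation.ReflTransGen (CommMove M) ((i :: ω).erase i) ((i :: ω').erase i) := by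
    generalize i :: ω = a at h1
    generalize i :: ω' = b at h1
    induction h1 with
    | refl => exact .refl
    | tail _ h ih => exact ih.trans (h.erase i)
  simpa using h2

theorem isFC_one : IsFC cs (1 : W) := by
  intro ω ω' hω hω' he he'
  have : ω = [] := by rw [← List.length_eq_zero_iff, ← hω.eq, he, cs.length_one]
  have h' : ω' = [] := by rw [← List.length_eq_zero_iff, ← hω'.eq, he', cs.length_one]
  rw [this, h']

end FullyCommutative

open Polynomial

/-! ### Degrees of Laurent polynomials -/

section Degree

theorem qh_zero : qh 0 = 1 := LaurentPolynomial.T_zero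

theorem qh_mul_qh (m n : ℤ) : qh m * qh n = qh (m + n) := (LaurentPolynomial.T_add m n).symm

theorem qh_mul_qh_assoc (m n : ℤ) (a : A) : qh m * (qh n * a) = qh (m + n) * a := by
  rw [← mul_assoc, qh_mul_qh]

theorem invert_qh (n : ℤ) : LaurentPolynomial.invert (qh n) = qh (-n) :=
  LaurentPolynomial.invert_T n

theorem coeff_qh (m n : ℤ) : (qh m).coeff n = if m = n then 1 else 0 :=
  LaurentPolynomial.T_apply n m

theorem coeff_qh_mul (m n : ℤ) (a : A) : (qh m * a).coeff n = a.coeff (n - m) := by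
  induction a using LaurentPolynomial.induction_on' with
  | add p q hp hq => simp [mul_add, hp, hq]
  | C_mul_T k r =>
    rw [qh, ← mul_assoc, mul_comm _ (LaurentPolynomial.C r), mul_assoc, ← LaurentPolynomial.T_add,
      ← LaurentPolynomial.smul_eq_C_mul, ← LaurentPolynomial.smul_eq_C_mul]
    simp only [AddMonoidAlgebra.coeff_smul, Finsupp.smul_apply, LaurentPolynomial.T_apply]
    congr 2
    simp only [eq_iff_iff]
    omega

theorem atq_X_pow (n : ℕ) : atq (X ^ n) = qh (2 * n) := by
  rw [atq, map_pow, aeval_X, qh, LaurentPolynomial.T_pow, mul_comm, qh]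

theorem atqh_X_pow (n : ℕ) : atqh (X ^ n) = qh (-n) := by
  rw [atqh, map_pow, aeval_X, qh, LaurentPolynomial.T_pow, qh]
  ring_nf

theorem atq_zero : atq 0 = 0 := map_zero _
theorem atq_one : atq 1 = 1 := map_one _
theorem atqh_zero : atqh 0 = 0 := map_zero _
theorem atqh_one : atqh 1 = 1 := map_one _

theorem atq_add (p p' : ℤ[X]) : atq (p + p') = atq p + atq p' := map_add _ _ _
theorem atq_mul (p p' : ℤ[X]) : atq (p * p') = atq p * atq p' := map_mul _ _ _
theorem atq_neg (p : ℤ[X]) : atq (-p) = -atq p := map_neg _ _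
theorem atq_sum {ι : Type*} (s : Finset ι) (f : ι → ℤ[X]) :
    atq (∑ k ∈ s, f k) = ∑ k ∈ s, atq (f k) := map_sum _ _ _

theorem coeff_atq (p : ℤ[X]) (n : ℤ) :
    (atq p).coeff n = if 0 ≤ n ∧ Even n then p.coeff (n / 2).toNat else 0 := by
  induction p using Polynomial.induction_on' with
  | add p q hp hq =>
    rw [atq_add, AddMonoidAlgebra.coeff_add, Finsupp.add_apply, hp, hq]
    split_ifs <;> simp
  | monomial k r =>
    rw [← C_mul_X_pow_eq_monomial, ← smul_eq_C_mul, atq, map_smul]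
    change (r • atq (X ^ k)).coeff n = _
    rw [atq_X_pow, AddMonoidAlgebra.coeff_smul, Finsupp.smul_apply, coeff_qh, coeff_smul,
      coeff_X_pow]
    by_cases h : 2 * (k : ℤ) = n
    · subst h
      simp
    · rw [if_neg h]
      split_ifs with h1 h2
      · exfalso
        obtain ⟨h3, h4⟩ := h1
        obtain ⟨c, rfl⟩ := h4
        omega
      · simp
      · simp

theorem coeff_atqh (p : ℤ[X]) (n : ℤ) :
    (atqh p).coeff n = if n ≤ 0 then p.coeff (-n).toNat else 0 := by
  induction p using Polynomial.induction_on' with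
  | add p q hp hq =>
    rw [show atqh (p + q) = atqh p + atqh q from map_add _ _ _, AddMonoidAlgebra.coeff_add,
      Finsupp.add_apply, hp, hq]
    split_ifs <;> simp
  | monomial k r =>
    rw [← C_mul_X_pow_eq_monomial, ← smul_eq_C_mul, atqh, map_smul]
    change (r • atqh (X ^ k)).coeff n = _
    rw [atqh_X_pow, AddMonoidAlgebra.coeff_smul, Finsupp.smul_apply, coeff_qh, coeff_smul,
      coeff_X_pow]
    by_cases h : -(k : ℤ) = n
    · subst h
      simp
    · rw [if_neg h]
      split_ifs with h1 h2
      · omega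
      · simp
      · simp

/-- The Laurent polynomials in `q^{1/2}` of degree at most `k`. -/
def degLE (k : ℤ) : AddSubgroup A where
  carrier := {a | ∀ n, k < n → a.coeff n = 0}
  add_mem' ha hb n hn := by simp [ha n hn, hb n hn]
  zero_mem' n _ := by simp
  neg_mem' ha n hn := by simp [ha n hn]

theorem degLE_mono {j k : ℤ} (h : j ≤ k) : degLE j ≤ degLE k :=
  fun _ ha n hn => ha n (h.trans_lt hn)

theorem qh_mem_degLE (n : ℤ) : qh n ∈ degLE n := fun k hk => by
  rw [coeff_qh, if_neg hk.ne]

theorem mul_mem_degLE {j k : ℤ} {a b : A} (ha : a ∈ degLE j) (hb : b ∈ degLE k) :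
    a * b ∈ degLE (j + k) := by
  intro n hn
  by_contra h
  have := AddMonoidAlgebra.support_coeff_mul_subset a b (Finsupp.mem_support_iff.2 h)
  obtain ⟨x, hx, y, hy, rfl⟩ := Finset.mem_add.1 this
  have h1 : x ≤ j := by
    by_contra h'
    exact Finsupp.mem_support_iff.1 hx (ha x (not_le.1 h'))
  have h2 : y ≤ k := by
    by_contra h'
    exact Finsupp.mem_support_iff.1 hy (hb y (not_le.1 h'))
  omega

theorem qh_mul_mem_degLE {m k : ℤ} {a : A} (ha : a ∈ degLE k) : qh m * a ∈ degLE (m + k) :=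
  mul_mem_degLE (qh_mem_degLE m) ha

theorem atqh_mem_degLE (p : ℤ[X]) : atqh p ∈ degLE 0 := fun n hn => by
  rw [coeff_atqh, if_neg (not_le.2 hn)]

theorem atqh_mem_degLE_neg_one {p : ℤ[X]} (hp : p.coeff 0 = 0) : atqh p ∈ degLE (-1) := by
  intro n hn
  rw [coeff_atqh]
  split_ifs with h
  · have : n = 0 := by omega
    simp [this, hp]
  · rfl

theorem eq_zero_of_invert_eq_self {a : A} (ha : a ∈ degLE (-1))
    (h : LaurentPolynomial.invert a = a) : a = 0 := by
  ext n
  rcases lt_or_ge (-1) n with hn | hn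
  · exact ha n hn
  · rw [← h, LaurentPolynomial.invert_apply]
    exact ha _ (by omega)

end Degree

end GenTL

noncomputable section

namespace GenTL

open CoxeterSystem Polynomial

/-! ### The standard basis elements of the Hecke algebra -/

section HeckeBasic

variable {B W : Type*} [Group W] {M : CoxeterMatrix B} (cs : CoxeterSystem M W)

theorem heckeGen_mul_self (i : B) :
    heckeGen M i * heckeGen M i = (qh 2 - 1) • heckeGen M i + qh 2 • 1 := by
  have := RingQuot.mkAlgHom_rel A (HeckeRel.quadratic (M := M) i)
  rw [map_mul, map_add, map_smul, AlgHom.commutes, Algebra.algebraMap_eq_smul_one] at this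
  exact this

theorem heckeGen_braid (i j : B) :
    ((braidWord M i j).map (heckeGen M)).prod = ((braidWord M j i).map (heckeGen M)).prod := by
  have := RingQuot.mkAlgHom_rel A (HeckeRel.braid (M := M) i j)
  rw [map_list_prod, map_list_prod, List.map_map, List.map_map] at this
  exact this

variable {cs} in
-- Matsumoto's theorem frees `Tw` from the reduced word selected by choice.
theorem Tw_eq_of_isReduced {ω : List B} (hω : cs.IsReduced ω) :
    Tw cs (cs.wordProd ω) = (ω.map (heckeGen M)).prod := by
  have h := Classical.choose_spec (cs.exists_isReduced (cs.wordProd ω))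
  exact cs.map_prod_eq_of_isReduced (heckeGen M) heckeGen_braid h.1 hω h.2.symm

theorem Tw_one : Tw cs 1 = 1 := by
  have : cs.IsReduced [] := by simp [CoxeterSystem.IsReduced]
  simpa using Tw_eq_of_isReduced this

variable {cs} in
theorem isReduced_cons_of_length_lt {i : B} {ω : List B} (hω : cs.IsReduced ω)
    (h : cs.length (cs.wordProd ω) < cs.length (cs.simple i * cs.wordProd ω)) :
    cs.IsReduced (i :: ω) := by
  unfold CoxeterSystem.IsReduced at *
  have := cs.length_simple_mul (cs.wordProd ω) i
  rw [wordProd_cons, List.length_cons]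
  omega

variable {cs} in
theorem heckeGen_mul_Tw_of_lt {i : B} {w : W} (h : cs.length w < cs.length (cs.simple i * w)) :
    heckeGen M i * Tw cs w = Tw cs (cs.simple i * w) := by
  obtain ⟨ω, hω, rfl⟩ := cs.exists_isReduced w
  rw [← wordProd_cons, Tw_eq_of_isReduced hω,
    Tw_eq_of_isReduced (isReduced_cons_of_length_lt hω h), List.map_cons, List.prod_cons]

variable {cs} in
theorem heckeGen_mul_Tw_of_gt {i : B} {w : W} (h : cs.length (cs.simple i * w) < cs.length w) :
    heckeGen M i * Tw cs w = (qh 2 - 1) • Tw cs w + qh 2 • Tw cs (cs.simple i * w) := by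
  have h1 : Tw cs w = heckeGen M i * Tw cs (cs.simple i * w) := by
    rw [heckeGen_mul_Tw_of_lt] <;> simp [h]
  conv_lhs => rw [h1, ← mul_assoc, heckeGen_mul_self]
  rw [add_mul, smul_mul_assoc, ← h1, smul_mul_assoc, one_mul]

theorem Tw_simple (i : B) : Tw cs (cs.simple i) = heckeGen M i := by
  have : cs.IsReduced [i] := by simp [CoxeterSystem.IsReduced]
  simpa using Tw_eq_of_isReduced this

/-- The inverse of a generator of the Hecke algebra. -/
def heckeGenInv (M : CoxeterMatrix B) (i : B) : Hecke M :=
  qh (-2) • heckeGen M i + (qh (-2) - 1) • 1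

theorem heckeGen_mul_heckeGenInv (i : B) : heckeGen M i * heckeGenInv M i = 1 := by
  have e : qh (-2) * qh 2 = 1 := by rw [qh_mul_qh, ← qh_zero]; rfl
  rw [heckeGenInv, mul_add, mul_smul_comm, heckeGen_mul_self, mul_smul_comm, mul_one, smul_add,
    smul_smul, smul_smul, mul_sub, e]
  module

theorem heckeGenInv_mul_heckeGen (i : B) : heckeGenInv M i * heckeGen M i = 1 := by
  have e : qh (-2) * qh 2 = 1 := by rw [qh_mul_qh, ← qh_zero]; rfl
  rw [heckeGenInv, add_mul, smul_mul_assoc, heckeGen_mul_self, smul_mul_assoc, one_mul, smul_add,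
    smul_smul, smul_smul, mul_sub, e]
  module

theorem heckeGenInv_mul_self (i : B) :
    heckeGenInv M i * heckeGenInv M i = (qh (-2) - 1) • heckeGenInv M i + qh (-2) • 1 := by
  nth_rw 1 [heckeGenInv]
  rw [add_mul, smul_mul_assoc, heckeGen_mul_heckeGenInv, smul_mul_assoc, one_mul, add_comm]

theorem prod_map_heckeGenInv_mul_prod (ω : List B) :
    (ω.map (heckeGenInv M)).prod * (ω.reverse.map (heckeGen M)).prod = 1 := by
  induction ω with
  | nil => simp
  | cons i ω ih =>
    simp only [List.map_cons, List.prod_cons, List.reverse_cons, List.map_append, List.prod_append,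
      List.map_nil, List.prod_nil, mul_one]
    rw [mul_assoc, ← mul_assoc (List.prod _), ih, one_mul, heckeGenInv_mul_heckeGen]

theorem prod_mul_prod_map_heckeGenInv (ω : List B) :
    (ω.reverse.map (heckeGen M)).prod * (ω.map (heckeGenInv M)).prod = 1 := by
  induction ω with
  | nil => simp
  | cons i ω ih =>
    simp only [List.map_cons, List.prod_cons, List.reverse_cons, List.map_append, List.prod_append,
      List.map_nil, List.prod_nil, mul_one]
    rw [mul_assoc, ← mul_assoc (heckeGen M i), heckeGen_mul_heckeGenInv, one_mul, ih]

/-- The product of inverses along a word inverts the product along the reversed word, and a reversed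
braid word is itself (odd length) or the opposite braid word (even length). -/
theorem heckeGenInv_braid (i j : B) :
    ((braidWord M i j).map (heckeGenInv M)).prod =
      ((braidWord M j i).map (heckeGenInv M)).prod := by
  have hrev : ∀ i j : B, ((braidWord M i j).reverse.map (heckeGen M)).prod =
      ((braidWord M i j).map (heckeGen M)).prod := by
    intro i j
    have h : (braidWord M i j).reverse = braidWord M i j ∨
        (braidWord M i j).reverse = braidWord M j i := by
      rcases Nat.even_or_odd (M i j) with h | h
      · right
        apply List.ext_getElem
        · simp [M.symmetric]
        · intro k h1 h2
          rw [List.getElem_reverse, getElem_alternatingWord _ _ _ _ (by simp at h1 ⊢; omega),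
            getElem_alternatingWord _ _ _ _ (by simpa using h2)]
          simp only [length_alternatingWord, M.symmetric j i] at h1 h2 ⊢
          simp only [List.length_reverse, length_alternatingWord] at h1
          grind
      · left
        apply List.ext_getElem
        · simp
        · intro k h1 h2
          rw [List.getElem_reverse, getElem_alternatingWord _ _ _ _ (by simp at h1 ⊢; omega),
            getElem_alternatingWord _ _ _ _ (by simpa using h2)]
          simp only [List.length_reverse, length_alternatingWord] at h1 h2 ⊢
          grind
    rcases h with h | h
    · rw [h]
    · rw [h, heckeGen_braid]
  have h1 := prod_map_heckeGenInv_mul_prod (M := M) (braidWord M i j)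
  have h2 := prod_mul_prod_map_heckeGenInv (M := M) (braidWord M j i)
  rw [hrev] at h1 h2
  rw [heckeGen_braid j i] at h2
  exact left_inv_eq_right_inv h1 h2

end HeckeBasic

/-! ### The bar involution of the Hecke algebra -/

section HeckeBar

variable {B W : Type*} [Group W] {M : CoxeterMatrix B} (cs : CoxeterSystem M W)

/-- The universal property of the Hecke algebra, for ring homomorphisms that need not be linear. -/
theorem exists_ringHom_hecke {R : Type*} [Ring R] (φ : A →+* R) (hφ : ∀ a x, φ a * x = x * φ a)
    (f : B → R) (hq : ∀ i, f i * f i = (φ (qh 2) - 1) * f i + φ (qh 2))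
    (hb : ∀ i j, ((braidWord M i j).map f).prod = ((braidWord M j i).map f).prod) :
    ∃ F : Hecke M →+* R, (∀ a, F (algebraMap A (Hecke M) a) = φ a) ∧
      ∀ i, F (heckeGen M i) = f i := by
  let _ : Algebra A R := φ.toAlgebra' hφ
  have hmap : ∀ a, algebraMap A R a = φ a := fun a => rfl
  have hrel : ∀ ⦃x y⦄, HeckeRel M x y → FreeAlgebra.lift A f x = FreeAlgebra.lift A f y := by
    intro x y h
    cases h with
    | quadratic i =>
      rw [map_mul, map_add, map_smul, AlgHom.commutes, FreeAlgebra.lift_ι_apply, hq,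
        Algebra.smul_def, hmap, hmap, map_sub, map_one]
    | braid i j =>
      rw [map_list_prod, map_list_prod, List.map_map, List.map_map]
      have : ⇑(FreeAlgebra.lift A f) ∘ FreeAlgebra.ι A = f := by
        funext i
        simp
      rw [this, hb]
  refine ⟨(RingQuot.liftAlgHom A ⟨FreeAlgebra.lift A f, hrel⟩ : Hecke M →ₐ[A] R).toRingHom,
    fun a => AlgHom.commutes _ a, fun i => ?_⟩
  change RingQuot.liftAlgHom A _ (heckeGen M i) = _
  rw [heckeGen, RingQuot.liftAlgHom_mkAlgHom_apply, FreeAlgebra.lift_ι_apply]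

theorem exists_heckeBar (M : CoxeterMatrix B) : ∃ ι : Hecke M →+* Hecke M,
    (∀ a, ι (algebraMap A _ a) = algebraMap A _ (LaurentPolynomial.invert a)) ∧
      ∀ i, ι (heckeGen M i) = heckeGenInv M i := by
  refine exists_ringHom_hecke ((algebraMap A (Hecke M)).comp
    (LaurentPolynomial.invert (R := ℤ) : A →+* A)) (fun a x => Algebra.commutes (LaurentPolynomial.invert a) x)
    (heckeGenInv M) (fun i => ?_) heckeGenInv_braid
  have h : ((algebraMap A (Hecke M)).comp (LaurentPolynomial.invert (R := ℤ) : A →+* A)) (qh 2) =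
      algebraMap A (Hecke M) (qh (-2)) := by
    rw [← invert_qh]; rfl
  rw [heckeGenInv_mul_self, h, Algebra.smul_def, Algebra.smul_def, mul_one, map_sub, map_one]

/-- The bar involution of the Hecke algebra. -/
def heckeBar (M : CoxeterMatrix B) : Hecke M →+* Hecke M := Classical.choose (exists_heckeBar M)

theorem heckeBar_heckeGen (i : B) : heckeBar M (heckeGen M i) = heckeGenInv M i :=
  (Classical.choose_spec (exists_heckeBar M)).2 i

theorem heckeBar_algebraMap (a : A) : heckeBar M (algebraMap A (Hecke M) a) =
    algebraMap A (Hecke M) (LaurentPolynomial.invert a) :=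
  (Classical.choose_spec (exists_heckeBar M)).1 a

theorem heckeBar_smul (a : A) (x : Hecke M) :
    heckeBar M (a • x) = LaurentPolynomial.invert a • heckeBar M x := by
  rw [Algebra.smul_def, map_mul, heckeBar_algebraMap, ← Algebra.smul_def]

theorem isBar_heckeBar : IsBar (Tw cs) (heckeBar M) := by
  refine ⟨heckeBar_algebraMap, fun w => ?_⟩
  obtain ⟨ω, hω, rfl⟩ := cs.exists_isReduced w
  rw [← wordProd_reverse, Tw_eq_of_isReduced hω, Tw_eq_of_isReduced hω.reverse, map_list_prod,
    List.map_map]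
  have : ⇑(heckeBar M) ∘ heckeGen M = heckeGenInv M := by
    funext i
    exact heckeBar_heckeGen i
  rw [this]
  exact ⟨prod_map_heckeGenInv_mul_prod ω, prod_mul_prod_map_heckeGenInv ω⟩

end HeckeBar

/-! ### The sign character -/

section Sign

variable {B W : Type*} [Group W] {M : CoxeterMatrix B} (cs : CoxeterSystem M W)

/-- The value -1 is a root of the quadratic relation (T + 1)(T - q) = 0. This character shows that 1
does not lie in J. -/
theorem exists_heckeSign (M : CoxeterMatrix B) : ∃ χ : Hecke M →+* A,
    (∀ a, χ (algebraMap A _ a) = a) ∧ ∀ i, χ (heckeGen M i) = -1 :=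
  exists_ringHom_hecke (RingHom.id A) (fun a x => mul_comm _ _) (fun _ => -1)
    (fun i => by simp) (fun i j => by simp [M.symmetric i j])

/-- The character of the Hecke algebra that maps every generator to `-1`. -/
def heckeSign (M : CoxeterMatrix B) : Hecke M →+* A := Classical.choose (exists_heckeSign M)

theorem heckeSign_Tw (w : W) : heckeSign M (Tw cs w) = (-1) ^ cs.length w := by
  obtain ⟨ω, hω, rfl⟩ := cs.exists_isReduced w
  rw [Tw_eq_of_isReduced hω, map_list_prod, List.map_map]
  have : ⇑(heckeSign M) ∘ heckeGen M = fun _ => -1 := by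
    funext i
    exact (Classical.choose_spec (exists_heckeSign M)).2 i
  rw [this, hω.eq]
  simp

/-- On a generator of J the terms at w and s_i w cancel, because their lengths differ by one. -/
theorem heckeSign_eq_zero_of_mem {h : Hecke M} (hh : h ∈ idealJ cs) : heckeSign M h = 0 := by
  have hadd : ∀ x y : Hecke M, heckeSign M (x + y) = heckeSign M x + heckeSign M y := map_add _
  have hzero : heckeSign M 0 = 0 := (heckeSign M).map_zero
  have hneg : ∀ x : Hecke M, heckeSign M (-x) = -heckeSign M x := fun x =>
    eq_neg_of_add_eq_zero_left
      ((hadd _ _).symm.trans ((congrArg _ (neg_add_cancel x)).trans hzero))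
  have hmul : ∀ x y : Hecke M, heckeSign M (x * y) = heckeSign M x * heckeSign M y := map_mul _
  refine TwoSidedIdeal.span_induction (p := fun x _ => heckeSign M x = 0) ?_ hzero
    (fun x y _ _ hx hy => (hadd x y).trans (by rw [hx, hy, add_zero]))
    (fun x _ hx => (hneg x).trans (by rw [hx, neg_zero]))
    (fun a x _ hx => (hmul a x).trans (by rw [hx, mul_zero]))
    (fun a x _ hx => (hmul x a).trans (by rw [hx, zero_mul])) hh
  rintro _ ⟨i, j, -, rfl⟩
  have hT : ∀ w, Tw cs w ≠ 0 := by
    intro w h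
    have := heckeSign_Tw cs w
    rw [h, map_zero] at this
    exact pow_ne_zero _ (neg_ne_zero.2 one_ne_zero) this.symm
  have hsupp : Function.support (Tw cs) = Set.univ := by
    ext w
    simp [hT w]
  by_cases hf : (Subgroup.closure {cs.simple i, cs.simple j} : Set W).Finite
  · rw [finsum_mem_eq_finite_toFinset_sum _ hf, map_sum]
    refine Finset.sum_involution (fun w _ => cs.simple i * w) ?_ ?_ ?_ ?_
    · intro w _
      rw [heckeSign_Tw, heckeSign_Tw]
      rcases cs.length_simple_mul w i with h | h
      · rw [h, pow_succ]; ring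
      · rw [← h, pow_succ]; ring
    · intro w _ _ h
      have := cs.length_simple_mul_ne w i
      rw [h] at this
      exact this rfl
    · intro w hw
      rw [Set.Finite.mem_toFinset, SetLike.mem_coe] at hw ⊢
      exact mul_mem (Subgroup.subset_closure (by simp)) hw
    · intro w _
      simp
  -- No `Tw` vanishes, so over an infinite subgroup the `finsum` has its default value 0; finiteness
  -- of the dihedral group is not needed.
  · rw [finsum_mem_eq_zero_of_infinite (by rwa [hsupp, Set.inter_univ]), map_zero]

theorem proj_one_ne_zero : proj cs 1 ≠ 0 := by
  intro h
  have h1 : (idealJ cs).ringCon 1 0 := by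
    rw [← map_zero (proj cs)] at h
    exact (RingCon.eq _).1 h
  have := heckeSign_eq_zero_of_mem cs ((TwoSidedIdeal.mem_iff _ _).2 h1)
  simp at this

end Sign

/-! ### Existence of the Kazhdan–Lusztig polynomials -/

section KazhdanLusztig

variable {B W : Type*} [Group W] {M : CoxeterMatrix B} (cs : CoxeterSystem M W)

/-- The lower interval of an element in the Bruhat order. -/
def low (w : W) : Finset W := (finite_setOf_bruhatLE (cs := cs) w).toFinset

variable {cs} in
theorem mem_low {x w : W} : x ∈ low cs w ↔ BruhatLE cs x w := by simp [low]

/-- The element `q^{-ℓ(w)/2} ∑_{x ≤ w} p_x(q) T_x`. -/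
def klSum (p : W → ℤ[X]) (w : W) : Hecke M :=
  qh (-(cs.length w : ℤ)) • ∑ x ∈ low cs w, atq (p x) • Tw cs x

theorem klElem_eq_klSum (P : W → W → ℤ[X]) (w : W) :
    klElem cs P w = klSum cs (fun x => P x w) w := by
  rw [klElem, finsum_mem_eq_finite_toFinset_sum _ (finite_setOf_bruhatLE w)]
  rfl

/-- The characterization of the Kazhdan–Lusztig polynomials for a fixed upper index. -/
structure IsKLColumn (w : W) (p : W → ℤ[X]) : Prop where
  self : p w = 1
  eq_zero : ∀ x, ¬ BruhatLE cs x w → p x = 0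
  natDegree_le : ∀ x, BruhatLT cs x w → 2 * (p x).natDegree + 1 ≤ cs.length w - cs.length x
  bar : heckeBar M (klSum cs p w) = klSum cs p w

variable {cs}

theorem IsKLColumn.coeff_eq_zero {w x : W} {p : W → ℤ[X]} (h : IsKLColumn cs w p) (hx : x ≠ w)
    {k : ℕ} (hk : cs.length w < 2 * k + 1 + cs.length x) : (p x).coeff k = 0 := by
  by_cases hle : BruhatLE cs x w
  · have := h.natDegree_le x ⟨hle, hx⟩
    exact coeff_eq_zero_of_natDegree_lt (by omega)
  · rw [h.eq_zero x hle, coeff_zero]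

theorem klSum_eq_sum_of_subset {w : W} {p : W → ℤ[X]} (h : ∀ x, ¬ BruhatLE cs x w → p x = 0)
    {s : Finset W} (hs : low cs w ⊆ s) :
    klSum cs p w = qh (-(cs.length w : ℤ)) • ∑ x ∈ s, atq (p x) • Tw cs x := by
  rw [klSum]
  congr 1
  refine Finset.sum_subset hs fun x _ hx => ?_
  rw [h x (fun h' => hx (mem_low.2 h')), atq_zero, zero_smul]

/-- The Kazhdan–Lusztig element of a generator. -/
def klGen (M : CoxeterMatrix B) (i : B) : Hecke M := qh (-1) • (heckeGen M i + 1)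

theorem heckeBar_klGen (i : B) : heckeBar M (klGen M i) = klGen M i := by
  rw [klGen, heckeBar_smul, map_add, map_one, heckeBar_heckeGen, heckeGenInv, invert_qh, add_assoc]
  have : (qh (-2) - 1) • (1 : Hecke M) + 1 = qh (-2) • 1 := by
    conv_lhs => rw [← one_smul A (1 : Hecke M), smul_smul, mul_one, ← add_smul, sub_add_cancel]
  rw [this, ← smul_add, smul_smul, qh_mul_qh]
  rfl

open Classical in
/-- The factor by which `T_s + 1` multiplies `T_x + T_{sx}`. -/
def descentFactor (cs : CoxeterSystem M W) (i : B) (x : W) : ℤ[X] :=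
  if cs.length (cs.simple i * x) < cs.length x then X else 1

theorem descentFactor_of_lt {i : B} {x : W} (h : cs.length (cs.simple i * x) < cs.length x) :
    descentFactor cs i x = X := if_pos h

theorem descentFactor_of_gt {i : B} {x : W} (h : cs.length x < cs.length (cs.simple i * x)) :
    descentFactor cs i x = 1 := if_neg (not_lt.2 h.le)

theorem heckeGen_add_one_mul_Tw (i : B) (x : W) :
    (heckeGen M i + 1) * Tw cs x =
      atq (descentFactor cs i x) • (Tw cs (cs.simple i * x) + Tw cs x) := by
  rw [add_mul, one_mul]
  rcases lt_or_gt_of_ne (cs.length_simple_mul_ne x i) with h | h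
  · rw [heckeGen_mul_Tw_of_gt h, descentFactor_of_lt h, ← pow_one X, atq_X_pow, smul_add]
    have : (qh 2 - 1) • Tw cs x + Tw cs x = qh 2 • Tw cs x := by
      nth_rw 2 [← one_smul A (Tw cs x)]
      rw [← add_smul, sub_add_cancel]
    rw [add_right_comm, this, add_comm]
    rfl
  · rw [heckeGen_mul_Tw_of_lt h, descentFactor_of_gt h, atq_one, one_smul]

/-- Since sw < w, the map x ↦ sx permutes the lower interval of w, so the T_{sx} can be reindexed.
-/
theorem heckeGen_add_one_mul_sum {i : B} {w : W}
    (hw : cs.length (cs.simple i * w) < cs.length w) (p : W → ℤ[X]) :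
    (heckeGen M i + 1) * ∑ x ∈ low cs w, atq (p x) • Tw cs x =
      ∑ x ∈ low cs w, atq (descentFactor cs i x * p x +
        descentFactor cs i (cs.simple i * x) * p (cs.simple i * x)) • Tw cs x := by
  have h1 : ∀ x, (heckeGen M i + 1) * (atq (p x) • Tw cs x) =
      atq (descentFactor cs i x * p x) • Tw cs (cs.simple i * x) +
        atq (descentFactor cs i x * p x) • Tw cs x := by
    intro x
    rw [mul_smul_comm, heckeGen_add_one_mul_Tw, smul_smul, ← atq_mul, mul_comm (p x), smul_add]
  have h2 : ∑ x ∈ low cs w, atq (descentFactor cs i x * p x) • Tw cs (cs.simple i * x) =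
      ∑ x ∈ low cs w, atq (descentFactor cs i (cs.simple i * x) * p (cs.simple i * x)) •
        Tw cs x := by
    refine Finset.sum_bij (fun x _ => cs.simple i * x)
      (fun x hx => mem_low.2 ((mem_low.1 hx).simple_mul_left hw))
      (fun x _ y _ h => mul_left_cancel h)
      (fun x hx => ⟨cs.simple i * x, mem_low.2 ((mem_low.1 hx).simple_mul_left hw), by simp⟩)
      (fun x _ => by simp)
  rw [Finset.mul_sum, Finset.sum_congr rfl fun x _ => h1 x, Finset.sum_add_distrib, h2,
    ← Finset.sum_add_distrib]
  refine Finset.sum_congr rfl fun x _ => ?_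
  rw [← add_smul, ← atq_add, add_comm]

variable (cs) in
open Classical in
/-- The descents that contribute to the multiplication of `C'_v` by `C'_s`. -/
def descentsBelow (i : B) (v : W) : Finset W :=
  (low cs v).filter fun z => cs.length (cs.simple i * z) < cs.length z

theorem mem_descentsBelow {i : B} {v z : W} : z ∈ descentsBelow cs i v ↔
    BruhatLE cs z v ∧ cs.length (cs.simple i * z) < cs.length z := by
  simp [descentsBelow, mem_low]

variable (cs) in
/-- The coefficient of `q^{(ℓ(w) - ℓ(x) - 1)/2}` in `p_x`. -/
def topCoeff (p : W → ℤ[X]) (x w : W) : ℤ :=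
  if Odd (cs.length w - cs.length x) then (p x).coeff ((cs.length w - cs.length x - 1) / 2) else 0

variable (cs) in
/-- The recursion for the Kazhdan–Lusztig polynomials. -/
def klStep (i : B) (w : W) (p : W → W → ℤ[X]) (x : W) : ℤ[X] :=
  descentFactor cs i x * p (cs.simple i * w) x +
    descentFactor cs i (cs.simple i * x) * p (cs.simple i * w) (cs.simple i * x) +
    ∑ z ∈ descentsBelow cs i (cs.simple i * w),
      -(C (topCoeff cs (p (cs.simple i * w)) z (cs.simple i * w)) *
        X ^ ((cs.length w - cs.length z) / 2) * p z x)

/-! ### Verification of one step of the Kazhdan–Lusztig recursion -/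

section Step

variable {i : B} {w : W} {p : W → W → ℤ[X]}
  (hw : cs.length (cs.simple i * w) < cs.length w)
  (hp : ∀ z, cs.length z < cs.length w → IsKLColumn cs z (p z))
include hw hp

theorem klStep_eq_zero {x : W} (hx : ¬ BruhatLE cs x w) : klStep cs i w p x = 0 := by
  have hvw : BruhatLE cs (cs.simple i * w) w := simple_mul_bruhatLE hw
  have h1 : p (cs.simple i * w) x = 0 := (hp _ hw).eq_zero _ fun h => hx (h.trans hvw)
  have h2 : p (cs.simple i * w) (cs.simple i * x) = 0 := (hp _ hw).eq_zero _ fun h => hx (by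
    have := (h.trans hvw).simple_mul_left hw
    simpa using this)
  rw [klStep, h1, h2, mul_zero, mul_zero, zero_add, zero_add]
  refine Finset.sum_eq_zero fun z hz => ?_
  have hz' := (mem_descentsBelow.1 hz).1
  rw [(hp z (hz'.length_le.trans_lt hw)).eq_zero x fun h => hx (h.trans (hz'.trans hvw)), mul_zero,
    neg_zero]

theorem klStep_self : klStep cs i w p w = 1 := by
  have h1 : p (cs.simple i * w) w = 0 := (hp _ hw).eq_zero _ fun h => by
    have := h.length_le
    omega
  rw [klStep, h1, (hp _ hw).self, descentFactor_of_gt (x := cs.simple i * w) (by simpa using hw),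
    mul_zero, zero_add, mul_one]
  rw [Finset.sum_eq_zero, add_zero]
  intro z hz
  have hz' := (mem_descentsBelow.1 hz).1.length_le.trans_lt hw
  rw [(hp z hz').eq_zero w fun h => by have := h.length_le; omega, mul_zero, neg_zero]

/-- The power of q shifts the degree bound for z to the one for w. When its exponent is not
integral, `topCoeff` is 0, so the truncated division is harmless. -/
theorem coeff_term_eq_zero {x z : W} (hz : z ∈ descentsBelow cs i (cs.simple i * w)) (hxz : x ≠ z)
    {k : ℕ} (hk : cs.length w < 2 * k + 1 + cs.length x) :
    (-(C (topCoeff cs (p (cs.simple i * w)) z (cs.simple i * w)) *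
        X ^ ((cs.length w - cs.length z) / 2) * p z x)).coeff k = 0 := by
  have hz' := (mem_descentsBelow.1 hz).1.length_le
  rw [coeff_neg, mul_assoc, coeff_C_mul, coeff_X_pow_mul', neg_eq_zero]
  have hl := cs.length_simple_mul w i
  by_cases hodd : Odd (cs.length (cs.simple i * w) - cs.length z)
  · split_ifs with he
    · rw [(hp z (by omega)).coeff_eq_zero hxz, mul_zero]
      grind
    · rw [mul_zero]
  · rw [topCoeff, if_neg hodd, zero_mul]

/-- Only q p_v(x) with v = sw and sx < x can exceed the bound, and only by its top coefficient; the
summand z = x removes it. -/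
theorem klStep_coeff_eq_zero {x : W} (hx : BruhatLT cs x w) {k : ℕ}
    (hk : cs.length w < 2 * k + 1 + cs.length x) : (klStep cs i w p x).coeff k = 0 := by
  have hlw := cs.length_simple_mul w i
  have hlx := cs.length_simple_mul x i
  have hxw := hx.1.length_lt hx.2
  have hk0 : k ≠ 0 := by omega
  obtain ⟨k, rfl⟩ := Nat.exists_eq_succ_of_ne_zero hk0
  rw [Nat.succ_eq_add_one] at *
  have hsv : cs.length (cs.simple i * w) < cs.length (cs.simple i * (cs.simple i * w)) := by
    simpa using hw
  have hv := hp _ hw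
  rw [klStep, coeff_add, coeff_add, finsetSum_coeff]
  rcases lt_or_gt_of_ne (cs.length_simple_mul_ne x i) with h | h
  · have hxv : x ≠ cs.simple i * w := by
      rintro rfl
      omega
    have hsx : cs.simple i * x ≠ cs.simple i * w := fun he => hx.2 (mul_left_cancel he)
    rw [descentFactor_of_lt h, descentFactor_of_gt (by simpa using h), one_mul, coeff_X_mul,
      hv.coeff_eq_zero hsx (by omega), add_zero]
    by_cases hle : BruhatLE cs x (cs.simple i * w)
    · have hmem : x ∈ descentsBelow cs i (cs.simple i * w) := mem_descentsBelow.2 ⟨hle, h⟩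
      rw [Finset.sum_eq_single x (fun z hz hzx => coeff_term_eq_zero hw hp hz hzx.symm hk)
        (fun h' => absurd hmem h'), (hp x hxw).self, mul_one, coeff_neg, coeff_C_mul, coeff_X_pow]
      by_cases hodd : Odd (cs.length (cs.simple i * w) - cs.length x)
      · rw [topCoeff, if_pos hodd]
        by_cases hkk : 2 * (k + 1) + cs.length x = cs.length w
        · have e1 : (cs.length (cs.simple i * w) - cs.length x - 1) / 2 = k := by omega
          have e2 : k + 1 = (cs.length w - cs.length x) / 2 := by omega
          rw [e1, if_pos e2, mul_one, add_neg_cancel]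
        · have e2 : ¬ k + 1 = (cs.length w - cs.length x) / 2 := by grind
          rw [if_neg e2, hv.coeff_eq_zero hxv (by omega)]
          simp
      · rw [topCoeff, if_neg hodd, hv.coeff_eq_zero hxv (by grind)]
        simp
    · rw [hv.eq_zero x hle, coeff_zero, zero_add]
      refine Finset.sum_eq_zero fun z hz => coeff_term_eq_zero hw hp hz ?_ hk
      rintro rfl
      exact hle (mem_descentsBelow.1 hz).1
  · have hsx : cs.simple i * x ≠ cs.simple i * w := fun he => hx.2 (mul_left_cancel he)
    rw [descentFactor_of_gt h, descentFactor_of_lt (by simpa using h), one_mul, coeff_X_mul,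
      hv.coeff_eq_zero hsx (by omega), add_zero, Finset.sum_eq_zero, add_zero]
    · by_cases hxv : x = cs.simple i * w
      · rw [hxv, hv.self, coeff_one, if_neg (by omega)]
      · exact hv.coeff_eq_zero hxv (by omega)
    · intro z hz
      refine coeff_term_eq_zero hw hp hz ?_ hk
      rintro rfl
      have := (mem_descentsBelow.1 hz).2
      omega

/-- In this form, C'_s C'_v - ∑ μ(z,v) C'_z, bar invariance of the recursion is evident. -/
theorem klSum_klStep : klSum cs (klStep cs i w p) w =
    klGen M i * klSum cs (p (cs.simple i * w)) (cs.simple i * w) +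
      ∑ z ∈ descentsBelow cs i (cs.simple i * w),
        (-(topCoeff cs (p (cs.simple i * w)) z (cs.simple i * w)) : A) • klSum cs (p z) z := by
  have hlw := cs.length_simple_mul w i
  have hvw : BruhatLE cs (cs.simple i * w) w := simple_mul_bruhatLE hw
  have hsub : ∀ z, BruhatLE cs z (cs.simple i * w) → low cs z ⊆ low cs w := fun z hz x hx =>
    mem_low.2 ((mem_low.1 hx).trans (hz.trans hvw))
  have h1 : klGen M i * klSum cs (p (cs.simple i * w)) (cs.simple i * w) =
      qh (-(cs.length w : ℤ)) • ∑ x ∈ low cs w, atq (descentFactor cs i x *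
        p (cs.simple i * w) x + descentFactor cs i (cs.simple i * x) *
          p (cs.simple i * w) (cs.simple i * x)) • Tw cs x := by
    rw [klSum_eq_sum_of_subset (hp _ hw).eq_zero (hsub _ (.refl _)), klGen, smul_mul_smul_comm,
      heckeGen_add_one_mul_sum hw, qh_mul_qh]
    congr 2
    omega
  have h2 : ∀ z ∈ descentsBelow cs i (cs.simple i * w),
      (-(topCoeff cs (p (cs.simple i * w)) z (cs.simple i * w)) : A) • klSum cs (p z) z =
      qh (-(cs.length w : ℤ)) • ∑ x ∈ low cs w,
        atq (-(C (topCoeff cs (p (cs.simple i * w)) z (cs.simple i * w)) *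
          X ^ ((cs.length w - cs.length z) / 2) * p z x)) • Tw cs x := by
    intro z hz
    have hz' := (mem_descentsBelow.1 hz).1
    have hl := hz'.length_le
    rw [klSum_eq_sum_of_subset (hp z (by omega)).eq_zero (hsub z hz'), smul_smul, Finset.smul_sum,
      Finset.smul_sum]
    refine Finset.sum_congr rfl fun x _ => ?_
    rw [smul_smul, smul_smul]
    congr 1
    by_cases hodd : Odd (cs.length (cs.simple i * w) - cs.length z)
    · have e : -(cs.length w : ℤ) + 2 * ((cs.length w - cs.length z) / 2 : ℕ) =
          -(cs.length z : ℤ) := by grind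
      have hC : ∀ m : ℤ, atq (C m) = (m : A) := fun m => by
        rw [atq, aeval_C, eq_intCast]
      rw [atq_neg, atq_mul, atq_mul, atq_X_pow, hC, ← e, ← qh_mul_qh]
      ring
    · rw [topCoeff, if_neg hodd]
      simp [atq_zero]
  rw [h1, Finset.sum_congr rfl h2, ← Finset.smul_sum, ← smul_add, Finset.sum_comm,
    ← Finset.sum_add_distrib, klSum]
  congr 1
  refine Finset.sum_congr rfl fun x _ => ?_
  rw [← Finset.sum_smul, ← add_smul, ← atq_sum, ← atq_add]
  rfl

theorem isKLColumn_klStep : IsKLColumn cs w (klStep cs i w p) where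
  self := klStep_self hw hp
  eq_zero _ := klStep_eq_zero hw hp
  natDegree_le x hx := by
    have hxw := hx.1.length_lt hx.2
    have : (klStep cs i w p x).natDegree ≤ (cs.length w - cs.length x - 1) / 2 :=
      natDegree_le_iff_coeff_eq_zero.2 fun k hk => klStep_coeff_eq_zero hw hp hx (by omega)
    omega
  bar := by
    rw [klSum_klStep hw hp, map_add, map_mul, heckeBar_klGen, (hp _ hw).bar, map_sum]
    congr 1
    refine Finset.sum_congr rfl fun z hz => ?_
    have hz' := (mem_descentsBelow.1 hz).1.length_le
    rw [heckeBar_smul, (hp z (by omega)).bar, map_neg, map_intCast]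

end Step

variable (cs) in
theorem exists_isKLColumn (w : W) : ∃ p, IsKLColumn cs w p := by
  induction hn : cs.length w using Nat.strong_induction_on generalizing w with
  | _ n ih =>
    subst hn
    by_cases h1 : w = 1
    · subst h1
      have hle : ∀ {x : W}, BruhatLE cs x 1 → x = 1 := fun {x} h => by
        have := h.length_le
        rw [cs.length_one] at this
        exact cs.length_eq_zero_iff.1 (Nat.le_zero.1 this)
      classical
      refine ⟨fun x => if x = 1 then 1 else 0, by simp, fun x hx => if_neg ?_, ?_, ?_⟩
      · rintro rfl
        exact hx (.refl _)
      · exact fun x hx => absurd (hle hx.1) hx.2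
      · have : low cs (1 : W) = {1} := by
          ext x
          rw [mem_low, Finset.mem_singleton]
          exact ⟨hle, fun h => h ▸ .refl _⟩
        rw [klSum, this]
        simp [Tw_one, atq_one, qh_zero]
    · obtain ⟨i, hi⟩ := cs.exists_leftDescent_of_ne_one h1
      -- Stated for all z, so that `choose` yields a family indexed by all of `W`.
      have ih' : ∀ z : W, ∃ p, cs.length z < cs.length w → IsKLColumn cs z p := fun z => by
        by_cases h : cs.length z < cs.length w
        · obtain ⟨p, hp⟩ := ih _ h z rfl
          exact ⟨p, fun _ => hp⟩
        · exact ⟨0, fun h' => absurd h' h⟩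
      choose p hp using ih'
      exact ⟨_, isKLColumn_klStep hi hp⟩

variable (cs) in
theorem isKLFamily_klPoly : IsKLFamily cs (klPoly cs) := by
  have h : ∃ P, IsKLFamily cs P := by
    choose p hp using exists_isKLColumn cs
    refine ⟨fun x w => p w x, fun w => (hp w).self, fun x w => (hp w).eq_zero x,
      fun x w => (hp w).natDegree_le x, heckeBar M, isBar_heckeBar cs, fun w => ?_⟩
    rw [klElem_eq_klSum]
    exact (hp w).bar
  rw [klPoly, dif_pos h]
  exact Classical.choose_spec h

end KazhdanLusztig

/-! ### Bases of the Temperley–Lieb algebra -/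

section Basis

variable {B W : Type*} [Group W] {M : CoxeterMatrix B} {cs : CoxeterSystem M W}

theorem proj_klSum (p : W → ℤ[X]) (w : W) : proj cs (klSum cs p w) =
    qh (-(cs.length w : ℤ)) • ∑ x ∈ low cs w, atq (p x) • tw cs x := by
  rw [klSum, map_smul, map_sum]
  simp only [map_smul, tw]

theorem proj_CPrime (w : W) : proj cs (CPrime cs w) =
    qh (-(cs.length w : ℤ)) • ∑ x ∈ low cs w, atq (klPoly cs x w) • tw cs x := by
  rw [CPrime, klElem_eq_klSum, proj_klSum]

theorem proj_CPrime_one : proj cs (CPrime cs 1) = proj cs 1 := by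
  have : low cs (1 : W) = {1} := by
    ext x
    rw [mem_low, Finset.mem_singleton]
    refine ⟨fun h => ?_, fun h => h ▸ .refl _⟩
    have := h.length_le
    rw [cs.length_one] at this
    exact cs.length_eq_zero_iff.1 (Nat.le_zero.1 this)
  rw [proj_CPrime, this, Finset.sum_singleton, (isKLFamily_klPoly cs).1, atq_one, one_smul, tw,
    Tw_one, cs.length_one, Nat.cast_zero, neg_zero, qh_zero, one_smul]

/-- If there were no such family, `icPoly` would be 0 and so would c_1, whereas (Cw-0) gives c_1 =
σ(C'_1) = 1, which is nonzero. -/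
theorem isICFamily_icPoly (hX : ProjectsKLToIC cs) : IsICFamily cs (icPoly cs) := by
  by_cases h : ∃ L, IsICFamily cs L
  · rw [icPoly, dif_pos h]
    exact Classical.choose_spec h
  · exfalso
    have h1 := (hX 1).1 isFC_one
    rw [proj_CPrime_one, cw, icPoly, dif_neg h, icElem] at h1
    refine proj_one_ne_zero cs (h1.trans ?_)
    simp [atqh_zero]

theorem Lval_eq_zero (hX : ProjectsKLToIC cs) {x w : W}
    (h : ¬ (IsFC cs x ∧ IsFC cs w ∧ BruhatLE cs x w)) : Lval cs x w = 0 := by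
  rw [Lval, (isICFamily_icPoly hX).1 x w h, atqh_zero]

theorem Lval_self (hX : ProjectsKLToIC cs) {w : W} (hw : IsFC cs w) : Lval cs w w = 1 := by
  rw [Lval, (isICFamily_icPoly hX).2.1 w hw, atqh_one]

theorem Lval_mem_degLE (hX : ProjectsKLToIC cs) {x w : W} (h : x ≠ w) :
    Lval cs x w ∈ degLE (-1) :=
  atqh_mem_degLE_neg_one ((isICFamily_icPoly hX).2.2.1 x w h)

theorem Lval_mem_degLE_zero (cs : CoxeterSystem M W) (x w : W) : Lval cs x w ∈ degLE 0 :=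
  atqh_mem_degLE _

theorem cw_eq_sum (hX : ProjectsKLToIC cs) (w : W) : cw cs w =
    ∑ x ∈ low cs w, (qh (-(cs.length x : ℤ)) * Lval cs x w) • tw cs x := by
  have hf : {x : W | IsFC cs x ∧ BruhatLE cs x w}.Finite :=
    (finite_setOf_bruhatLE w).subset fun x hx => hx.2
  rw [cw, icElem, finsum_mem_eq_finite_toFinset_sum _ hf]
  refine Finset.sum_subset (fun x hx => ?_) fun x _ hx => ?_
  · exact mem_low.2 ((Set.Finite.mem_toFinset _).1 hx).2
  · rw [← Lval, Lval_eq_zero hX fun h => hx ((Set.Finite.mem_toFinset _).2 ⟨h.1, h.2.2⟩), mul_zero,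
      zero_smul]

theorem linearIndependent_cw (hX : ProjectsKLToIC cs) :
    LinearIndependent A fun w : {w : W // IsFC cs w} => cw cs w.1 :=
  (isICFamily_icPoly hX).2.2.2.2.1

theorem span_cw (hX : ProjectsKLToIC cs) :
    ⊤ ≤ Submodule.span A (Set.range fun w : {w : W // IsFC cs w} => cw cs w.1) :=
  (isICFamily_icPoly hX).2.2.2.2.2.ge

/-- The basis of the elements `c_w`. -/
def cwBasis (hX : ProjectsKLToIC cs) : Module.Basis {w : W // IsFC cs w} A (TL cs) :=
  Module.Basis.mk (linearIndependent_cw hX) (span_cw hX)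

theorem cwBasis_apply (hX : ProjectsKLToIC cs) (w : {w : W // IsFC cs w}) :
    cwBasis hX w = cw cs w.1 := by
  rw [cwBasis, Module.Basis.mk_apply]

variable (cs) in
open Classical in
/-- The coordinates of `c_w` with respect to the `t_x`. -/
def cwCoord (w : W) : {w : W // IsFC cs w} →₀ A :=
  ∑ x ∈ (low cs w).subtype (IsFC cs), Finsupp.single x (qh (-(cs.length x.1 : ℤ)) * Lval cs x.1 w)

theorem linearCombination_cwCoord (hX : ProjectsKLToIC cs) (w : W) :
    Finsupp.linearCombination A (fun x : {w : W // IsFC cs w} => tw cs x.1) (cwCoord cs w) =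
      cw cs w := by
  classical
  rw [cwCoord, map_sum, cw_eq_sum hX]
  simp only [Finsupp.linearCombination_single]
  rw [Finset.sum_subtype_eq_sum_filter
    (f := fun x => (qh (-(cs.length x : ℤ)) * Lval cs x w) • tw cs x)]
  refine Finset.sum_filter_of_ne fun x _ h => ?_
  by_contra hx
  exact h (by rw [Lval_eq_zero hX fun h' => hx h'.1, mul_zero, zero_smul])

/-- Triangularity: the entry of c_w at w is the unit q^{-ℓ(w)/2}, and its other entries sit at
shorter elements, covered by induction. -/
theorem single_mem_range_cwCoord (hX : ProjectsKLToIC cs) (w : {w : W // IsFC cs w}) (a : A) :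
    Finsupp.single w a ∈ LinearMap.range
      (Finsupp.linearCombination A fun x : {w : W // IsFC cs w} => cwCoord cs x.1) := by
  classical
  induction hn : cs.length w.1 using Nat.strong_induction_on generalizing w a with
  | _ n ih =>
    have hmem : w ∈ (low cs w.1).subtype (IsFC cs) := by simp [mem_low, BruhatLE.refl]
    have h1 : cwCoord cs w.1 ∈ LinearMap.range
        (Finsupp.linearCombination A fun x : {w : W // IsFC cs w} => cwCoord cs x.1) :=
      ⟨Finsupp.single w 1, by simp⟩
    have h2 : cwCoord cs w.1 = Finsupp.single w (qh (-(cs.length w.1 : ℤ))) +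
        ∑ x ∈ ((low cs w.1).subtype (IsFC cs)).erase w,
          Finsupp.single x (qh (-(cs.length x.1 : ℤ)) * Lval cs x.1 w.1) := by
      rw [cwCoord, ← Finset.add_sum_erase _ _ hmem, Lval_self hX w.2, mul_one]
    rw [h2] at h1
    have h3 := (Submodule.add_mem_iff_left _ (Submodule.sum_mem _ fun x hx => ?_)).1 h1
    · have := Submodule.smul_mem _ (a * qh (cs.length w.1 : ℤ)) h3
      rwa [Finsupp.smul_single, smul_eq_mul, mul_assoc, qh_mul_qh, add_neg_cancel, qh_zero,
        mul_one] at this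
    · rw [Finset.mem_erase, Finset.mem_subtype, mem_low] at hx
      exact ih _ (hn ▸ hx.2.length_lt fun h => hx.1 (Subtype.ext h)) _ _ rfl

/-- The map f ↦ ∑ f_w c_w is injective and factors as the surjective transition map followed by f ↦
∑ f_x t_x; hence the latter is injective. -/
theorem linearIndependent_tw (hX : ProjectsKLToIC cs) :
    LinearIndependent A fun x : {w : W // IsFC cs w} => tw cs x.1 := by
  have hsurj : Function.Surjective
      (Finsupp.linearCombination A fun x : {w : W // IsFC cs w} => cwCoord cs x.1) := by
    intro f
    induction f using Finsupp.induction_linear with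
    | zero => exact ⟨0, map_zero _⟩
    | add f g hf hg =>
      obtain ⟨a, rfl⟩ := hf
      obtain ⟨b, rfl⟩ := hg
      exact ⟨a + b, map_add _ _ _⟩
    | single w a => exact single_mem_range_cwCoord hX w a
  have hcomp : ∀ f, Finsupp.linearCombination A (fun x : {w : W // IsFC cs w} => tw cs x.1)
      (Finsupp.linearCombination A (fun x : {w : W // IsFC cs w} => cwCoord cs x.1) f) =
      Finsupp.linearCombination A (fun x : {w : W // IsFC cs w} => cw cs x.1) f := by
    intro f
    induction f using Finsupp.induction_linear with
    | zero => simp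
    | add f g hf hg => rw [map_add, map_add, hf, hg, map_add]
    | single w a => simp [linearCombination_cwCoord hX]
  have hc : Function.Injective (Finsupp.linearCombination A
      (fun x : {w : W // IsFC cs w} => cw cs x.1)) := linearIndependent_cw hX
  intro f g hfg
  obtain ⟨a, rfl⟩ := hsurj f
  obtain ⟨b, rfl⟩ := hsurj g
  rw [hcomp, hcomp] at hfg
  rw [hc hfg]

theorem span_tw (hX : ProjectsKLToIC cs) :
    ⊤ ≤ Submodule.span A (Set.range fun x : {w : W // IsFC cs w} => tw cs x.1) := by
  refine (span_cw hX).trans (Submodule.span_le.2 ?_)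
  rintro _ ⟨w, rfl⟩
  change cw cs w.1 ∈ _
  rw [← linearCombination_cwCoord hX, ← Finsupp.range_linearCombination]
  exact ⟨_, rfl⟩

/-- The basis of the elements `t_w`. -/
def twBasis (hX : ProjectsKLToIC cs) : Module.Basis {w : W // IsFC cs w} A (TL cs) :=
  Module.Basis.mk (linearIndependent_tw hX) (span_tw hX)

open Classical in
/-- The coordinate of an element of the Temperley–Lieb algebra at `q^{-ℓ(x)/2} t_x`. -/
def twCoord (hX : ProjectsKLToIC cs) (x : W) : TL cs →ₗ[A] A :=
  if h : IsFC cs x then qh (cs.length x) • (twBasis hX).coord ⟨x, h⟩ else 0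

open Classical in
theorem twCoord_tw (hX : ProjectsKLToIC cs) {x y : W} (hx : IsFC cs x) (hy : IsFC cs y) :
    twCoord hX x (tw cs y) = if y = x then qh (cs.length x) else 0 := by
  have : tw cs y = twBasis hX ⟨y, hy⟩ := by rw [twBasis, Module.Basis.mk_apply]
  rw [twCoord, dif_pos hx, this, LinearMap.smul_apply, Module.Basis.coord_apply,
    Module.Basis.repr_self, Finsupp.single_apply]
  simp

theorem twCoord_cw (hX : ProjectsKLToIC cs) {x : W} (w : W) (hx : IsFC cs x) :
    twCoord hX x (cw cs w) = Lval cs x w := by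
  classical
  have hterm : ∀ y, twCoord hX x ((qh (-(cs.length y : ℤ)) * Lval cs y w) • tw cs y) =
      if y = x then Lval cs x w else 0 := by
    intro y
    by_cases hy : IsFC cs y
    · rw [map_smul, twCoord_tw hX hx hy]
      split_ifs with h
      · rw [h, smul_eq_mul, mul_comm, qh_mul_qh_assoc, add_neg_cancel, qh_zero, one_mul]
      · exact smul_zero _
    · rw [Lval_eq_zero hX fun h => hy h.1, mul_zero, zero_smul, map_zero, if_neg]
      rintro rfl
      exact hy hx
  rw [cw_eq_sum hX, map_sum, Finset.sum_congr rfl fun y _ => hterm y, Finset.sum_ite_eq']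
  split_ifs with h
  · rfl
  · rw [Lval_eq_zero hX fun h' => h (mem_low.2 h'.2.2)]

end Basis

/-! ### The polynomials `D_{x,w}` -/

section DPoly

variable {B W : Type*} [Group W] {M : CoxeterMatrix B} {cs : CoxeterSystem M W}

open Classical in
-- This is σ(C'_w) = 0 solved for its leading term.
theorem tw_eq_sum_of_not_isFC (hX : ProjectsKLToIC cs) {w : W} (hw : ¬ IsFC cs w) :
    tw cs w = ∑ y ∈ (low cs w).erase w, atq (-klPoly cs y w) • tw cs y := by
  have h := (hX w).2 hw
  rw [proj_CPrime, ← Finset.add_sum_erase _ _ (mem_low.2 (.refl w)), (isKLFamily_klPoly cs).1,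
    atq_one, one_smul] at h
  have h' := congrArg (fun a => qh (cs.length w) • a) h
  simp only [smul_zero] at h'
  rw [smul_smul, qh_mul_qh, add_neg_cancel, qh_zero, one_smul] at h'
  rw [eq_neg_of_add_eq_zero_left h', ← Finset.sum_neg_distrib]
  refine Finset.sum_congr rfl fun y _ => ?_
  rw [atq_neg, neg_smul]

/-- Existence by induction on length: for w outside W_c, D_{x,w} = -∑ P_{y,w} D_{x,y} over y < w.
The coefficients P_{y,w} keep it polynomial in q. -/
theorem isDFamily_dPoly (hX : ProjectsKLToIC cs) : IsDFamily cs (dPoly cs) := by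
  classical
  have hfin : ∀ w, {x : W | IsFC cs x ∧ BruhatLE cs x w}.Finite := fun w =>
    (finite_setOf_bruhatLE w).subset fun x hx => hx.2
  have hex : ∀ w, ∃ f : W → ℤ[X], (∀ x, ¬ (IsFC cs x ∧ BruhatLE cs x w) → f x = 0) ∧
      (IsFC cs w → f w = 1) ∧ tw cs w = ∑ x ∈ low cs w, atq (f x) • tw cs x := by
    intro w
    induction hn : cs.length w using Nat.strong_induction_on generalizing w with
    | _ n ih =>
      subst hn
      by_cases hw : IsFC cs w
      · refine ⟨fun x => if x = w then 1 else 0, fun x hx => if_neg ?_, fun _ => if_pos rfl, ?_⟩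
        · rintro rfl
          exact hx ⟨hw, .refl _⟩
        · rw [Finset.sum_eq_single w]
          · simp [atq_one]
          · intro x _ hx
            simp [hx, atq_zero]
          · intro h
            exact absurd (mem_low.2 (.refl _)) h
      · have ih' : ∀ y : W, ∃ f : W → ℤ[X], y ∈ (low cs w).erase w →
            (∀ x, ¬ (IsFC cs x ∧ BruhatLE cs x y) → f x = 0) ∧
              tw cs y = ∑ x ∈ low cs y, atq (f x) • tw cs x := by
          intro y
          by_cases hy : y ∈ (low cs w).erase w
          · have hy' := Finset.mem_erase.1 hy
            obtain ⟨f, h1, -, h3⟩ := ih _ ((mem_low.1 hy'.2).length_lt hy'.1) y rfl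
            exact ⟨f, fun _ => ⟨h1, h3⟩⟩
          · exact ⟨0, fun h => absurd h hy⟩
        choose f hf using ih'
        refine ⟨fun x => ∑ y ∈ (low cs w).erase w, -klPoly cs y w * f y x, fun x hx => ?_,
          fun h => absurd h hw, ?_⟩
        · refine Finset.sum_eq_zero fun y hy => ?_
          rw [(hf y hy).1 x fun h => hx ⟨h.1, h.2.trans (mem_low.1 (Finset.mem_of_mem_erase hy))⟩,
            mul_zero]
        · rw [tw_eq_sum_of_not_isFC hX hw]
          simp only [atq_sum, Finset.sum_smul]
          rw [Finset.sum_comm]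
          refine Finset.sum_congr rfl fun y hy => ?_
          have hle := mem_low.1 (Finset.mem_of_mem_erase hy)
          rw [(hf y hy).2, Finset.smul_sum]
          simp only [atq_mul, ← smul_smul]
          refine Finset.sum_subset (fun x hx => mem_low.2 ((mem_low.1 hx).trans hle))
            fun x _ hx => ?_
          rw [(hf y hy).1 x fun h => hx (mem_low.2 h.2), atq_zero, zero_smul, smul_zero]
  have h : ∃ D, IsDFamily cs D := by
    choose f hf using hex
    refine ⟨fun x w => f w x, fun x w => (hf w).1 x, fun w => (hf w).2.1, fun w => ?_⟩
    rw [finsum_mem_eq_finite_toFinset_sum _ (hfin w)]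
    refine (hf w).2.2.trans (Finset.sum_subset (fun x hx => ?_) fun x _ hx => ?_).symm
    · exact mem_low.2 ((Set.Finite.mem_toFinset _).1 hx).2
    · rw [(hf w).1 x fun h => hx ((Set.Finite.mem_toFinset _).2 h), atq_zero, zero_smul]
  rw [dPoly, dif_pos h]
  exact Classical.choose_spec h

theorem twCoord_tw_eq_dPoly (hX : ProjectsKLToIC cs) {x : W} (w : W) (hx : IsFC cs x) :
    twCoord hX x (tw cs w) = qh (cs.length x) * atq (dPoly cs x w) := by
  classical
  have hfin : {x : W | IsFC cs x ∧ BruhatLE cs x w}.Finite :=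
    (finite_setOf_bruhatLE w).subset fun x hx => hx.2
  obtain ⟨h1, -, h3⟩ := isDFamily_dPoly hX
  rw [h3 w, finsum_mem_eq_finite_toFinset_sum _ hfin, map_sum,
    Finset.sum_congr rfl fun y hy => by
      rw [map_smul, twCoord_tw hX hx ((Set.Finite.mem_toFinset _).1 hy).1, smul_eq_mul, mul_ite,
        mul_zero], Finset.sum_ite_eq']
  split_ifs with h
  · rw [mul_comm]
  · rw [h1 x w fun h' => h ((Set.Finite.mem_toFinset _).2 h'), atq_zero, mul_zero]

/-! ### Degree estimates for normalized coefficients -/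

/-- The normalized Kazhdan–Lusztig polynomial `q^{(ℓ(x) - ℓ(w))/2} P_{x,w}`. -/
def klNorm (cs : CoxeterSystem M W) (x w : W) : A :=
  qh (cs.length x - cs.length w) * atq (klPoly cs x w)

/-- By the degree bound on P_{x,w}, the highest possible power is q^{-1/2}, and its coefficient is
μ(x,w). -/
theorem klNorm_sub_mem_degLE {x w : W} (h : x ≠ w) :
    klNorm cs x w - mu cs x w • qh (-1) ∈ degLE (-2) := by
  obtain ⟨-, h0, hdeg, -⟩ := isKLFamily_klPoly cs
  by_cases hle : BruhatLE cs x w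
  · have hl := hle.length_lt h
    have hd := hdeg x w ⟨hle, h⟩
    intro n hn
    rw [klNorm, AddMonoidAlgebra.coeff_sub, Finsupp.sub_apply, coeff_qh_mul, coeff_atq,
      AddMonoidAlgebra.coeff_smul, Finsupp.smul_apply, coeff_qh, mu]
    by_cases hn1 : n = -1
    · subst hn1
      by_cases hodd : Odd (cs.length w - cs.length x)
      · have e : ((-1 - ((cs.length x : ℤ) - cs.length w)) / 2).toNat =
            (cs.length w - cs.length x - 1) / 2 := by omega
        rw [if_pos ⟨by omega, by grind⟩, if_pos hodd, e]
        simp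
      · rw [if_neg (by grind), if_neg hodd]
        simp
    · rw [if_neg (Ne.symm hn1), smul_zero, sub_zero]
      split_ifs with h2
      · obtain ⟨c, hc⟩ := h2.2
        exact coeff_eq_zero_of_natDegree_lt (by omega)
      · rfl
  · have : klPoly cs x w = 0 := h0 x w hle
    rw [klNorm, mu, this]
    simp [atq_zero, (degLE (-2)).zero_mem]

theorem klNorm_mem_degLE {x w : W} (h : x ≠ w) : klNorm cs x w ∈ degLE (-1) := by
  have h1 := degLE_mono (k := -1) (by norm_num) (klNorm_sub_mem_degLE (cs := cs) h)
  have h2 := (degLE (-1)).add_mem h1 ((degLE (-1)).zsmul_mem (qh_mem_degLE (-1)) (mu cs x w))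
  rwa [sub_add_cancel] at h2

/-- The coordinate of `q^{-ℓ(w)/2} t_w` at `q^{-ℓ(x)/2} t_x`. -/
def dNorm (cs : CoxeterSystem M W) (x w : W) : A :=
  qh (cs.length x - cs.length w) * atq (dPoly cs x w)

theorem dNorm_eq_twCoord (hX : ProjectsKLToIC cs) {x : W} (w : W) (hx : IsFC cs x) :
    dNorm cs x w = twCoord hX x (qh (-(cs.length w : ℤ)) • tw cs w) := by
  rw [map_smul, twCoord_tw_eq_dPoly hX w hx, smul_eq_mul, qh_mul_qh_assoc, dNorm]
  congr 2
  ring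

open Classical in
theorem dNorm_of_isFC (hX : ProjectsKLToIC cs) {x w : W} (hx : IsFC cs x) (hw : IsFC cs w) :
    dNorm cs x w = if w = x then 1 else 0 := by
  rw [dNorm_eq_twCoord hX w hx, map_smul, twCoord_tw hX hx hw]
  split_ifs with h
  · rw [h, smul_eq_mul, qh_mul_qh, neg_add_cancel, qh_zero]
  · rw [smul_zero]

/-- In the recursion over y < w, the term y = x is a normalized P with only negative powers; every
other term is a product of two such factors, by induction. -/
theorem dNorm_mem_degLE (hX : ProjectsKLToIC cs) {x w : W} (hx : IsFC cs x) (h : x ≠ w) :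
    dNorm cs x w ∈ degLE (-1) := by
  classical
  induction hn : cs.length w using Nat.strong_induction_on generalizing w with
  | _ n ih =>
    subst hn
    by_cases hw : IsFC cs w
    · rw [dNorm_of_isFC hX hx hw, if_neg h.symm]
      exact (degLE (-1)).zero_mem
    · have : dNorm cs x w = ∑ y ∈ (low cs w).erase w, -(klNorm cs y w * dNorm cs x y) := by
        rw [dNorm_eq_twCoord hX w hx, tw_eq_sum_of_not_isFC hX hw, Finset.smul_sum, map_sum]
        refine Finset.sum_congr rfl fun y _ => ?_
        rw [dNorm_eq_twCoord hX y hx, smul_smul, map_smul, map_smul, klNorm, atq_neg, smul_eq_mul,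
          smul_eq_mul, sub_eq_neg_add, ← qh_mul_qh]
        have e : qh (cs.length y) * qh (-(cs.length y : ℤ)) = 1 := by
          rw [qh_mul_qh, add_neg_cancel, qh_zero]
        linear_combination (qh (-(cs.length w : ℤ)) * atq (klPoly cs y w) *
          twCoord hX x (tw cs y)) * e
      rw [this]
      refine (degLE (-1)).sum_mem fun y hy => (degLE (-1)).neg_mem ?_
      obtain ⟨hyw, hy⟩ := Finset.mem_erase.1 hy
      by_cases hxy : x = y
      · subst hxy
        rw [dNorm_of_isFC hX hx hx, if_pos rfl, mul_one]
        exact klNorm_mem_degLE hyw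
      · exact degLE_mono (by norm_num) (mul_mem_degLE (klNorm_mem_degLE hyw)
          (ih _ ((mem_low.1 hy).length_lt hyw) hxy rfl))

theorem Lval_eq_sum (hX : ProjectsKLToIC cs) {x w : W} (hx : IsFC cs x) (hw : IsFC cs w) :
    Lval cs x w = ∑ y ∈ low cs w, klNorm cs y w * dNorm cs x y := by
  rw [← twCoord_cw hX w hx, ← (hX w).1 hw, proj_CPrime, Finset.smul_sum, map_sum]
  refine Finset.sum_congr rfl fun y _ => ?_
  rw [dNorm_eq_twCoord hX y hx, ← smul_eq_mul, ← map_smul, smul_smul, smul_smul, klNorm]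
  congr 2
  have e : qh (cs.length y) * qh (-(cs.length y : ℤ)) = 1 := by
    rw [qh_mul_qh, add_neg_cancel, qh_zero]
  rw [sub_eq_neg_add, ← qh_mul_qh]
  linear_combination (-qh (-(cs.length w : ℤ)) * atq (klPoly cs y w)) * e

/-- In `Lval_eq_sum` the term y = x supplies μ(x,w) q^{-1/2}, the term y = w vanishes, and all
others are products of two factors of degree at most -1. -/
theorem Lval_sub_mem_degLE (hX : ProjectsKLToIC cs) {x w : W} (hx : IsFC cs x) (hw : IsFC cs w)
    (h : x ≠ w) : Lval cs x w - mu cs x w • qh (-1) ∈ degLE (-2) := by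
  classical
  by_cases hle : BruhatLE cs x w
  · rw [Lval_eq_sum hX hx hw, ← Finset.add_sum_erase _ _ (mem_low.2 hle),
      dNorm_of_isFC hX hx hx, if_pos rfl, mul_one, add_sub_right_comm]
    refine (degLE (-2)).add_mem (klNorm_sub_mem_degLE h) ((degLE (-2)).sum_mem fun y hy => ?_)
    obtain ⟨hyx, -⟩ := Finset.mem_erase.1 hy
    by_cases hyw : y = w
    · subst hyw
      rw [dNorm_of_isFC hX hx hw, if_neg h.symm, mul_zero]
      exact (degLE (-2)).zero_mem
    · exact mul_mem_degLE (klNorm_mem_degLE hyw) (dNorm_mem_degLE hX hx hyx.symm)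
  · have : klPoly cs x w = 0 := (isKLFamily_klPoly cs).2.1 x w hle
    rw [Lval_eq_zero hX fun h' => hle h'.2.2, mu, this]
    simp [(degLE (-2)).zero_mem]

end DPoly

/-! ### The product of `c_s` and `c_v` -/

section Recursion

variable {B W : Type*} [Group W] {M : CoxeterMatrix B} {cs : CoxeterSystem M W}

theorem bar_smul {R : Type*} [Ring R] [Algebra A R] {t : W → R} {ι : R →+* R} (h : IsBar t ι)
    (a : A) (x : R) : ι (a • x) = LaurentPolynomial.invert a • ι x := by
  rw [Algebra.smul_def, map_mul, h.1, ← Algebra.smul_def]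

theorem qh_smul_heckeGenInv_add_one (i : B) : qh 1 • (heckeGenInv M i + 1) = klGen M i := by
  have h := heckeBar_klGen (M := M) i
  nth_rw 1 [klGen] at h
  rwa [heckeBar_smul, map_add, map_one, heckeBar_heckeGen, invert_qh, neg_neg] at h

/-- A bar map is prescribed on the t_w only through inverses; uniqueness of the inverse of t_s
identifies ι(t_s) with the image of `heckeGenInv`. -/
theorem bar_proj_klGen {ι : TL cs →+* TL cs} (h : IsBar (tw cs) ι) (i : B) :
    ι (proj cs (klGen M i)) = proj cs (klGen M i) := by
  have h1 := (h.2 (cs.simple i)).1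
  rw [inv_simple, tw, Tw_simple] at h1
  have h2 : proj cs (heckeGen M i) * proj cs (heckeGenInv M i) = 1 := by
    rw [← map_mul, heckeGen_mul_heckeGenInv, map_one]
  have h3 := left_inv_eq_right_inv h1 h2
  conv_rhs => rw [← qh_smul_heckeGenInv_add_one, map_smul, map_add, map_one, ← h3]
  rw [klGen, map_smul, bar_smul h, map_add, map_one, map_add, map_one, invert_qh, neg_neg]

theorem proj_klGen_mul_tw (i : B) (z : W) : proj cs (klGen M i) * tw cs z =
    (qh (-1) * atq (descentFactor cs i z)) • (tw cs (cs.simple i * z) + tw cs z) := by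
  rw [tw, ← map_mul, klGen, smul_mul_assoc, heckeGen_add_one_mul_Tw, smul_smul, map_smul, map_add]
  rfl

open Classical in
-- With the normalization q^{-ℓ(z)/2} t_z, the term at sz has coefficient 1 whether s is a descent
-- of z or not; only the power q^{±1/2} at z itself depends on it.
theorem twCoord_proj_klGen_mul_tw (hX : ProjectsKLToIC cs) {i : B} {x z : W} (hx : IsFC cs x)
    (hz : IsFC cs z) :
    twCoord hX x (qh (-(cs.length z : ℤ)) • (proj cs (klGen M i) * tw cs z)) =
      dNorm cs x (cs.simple i * z) +
        if z = x then qh (2 * descentIndicator cs i x - 1) else 0 := by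
  rw [proj_klGen_mul_tw, smul_smul, map_smul, map_add, twCoord_tw hX hx hz, smul_eq_mul, mul_add,
    mul_ite, mul_zero]
  have hl := cs.length_simple_mul z i
  congr 1
  · rcases lt_or_gt_of_ne (cs.length_simple_mul_ne z i) with h | h
    · rw [descentFactor_of_lt h, dNorm_of_isFC hX hx (hz.simple_mul h),
        twCoord_tw hX hx (hz.simple_mul h), ← pow_one X, atq_X_pow, qh_mul_qh, qh_mul_qh]
      split_ifs with he
      · rw [qh_mul_qh, ← qh_zero, ← he]
        congr 1
        push_cast
        omega
      · rw [mul_zero]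
    · rw [descentFactor_of_gt h, dNorm_eq_twCoord hX _ hx, map_smul, atq_one, mul_one, qh_mul_qh,
        smul_eq_mul]
      congr 2
      omega
  · split_ifs with he
    · subst he
      rw [descentIndicator]
      simp only [bruhatLT_simple_mul_iff]
      rcases lt_or_gt_of_ne (cs.length_simple_mul_ne z i) with h | h
      · rw [descentFactor_of_lt h, if_pos h, ← pow_one X, atq_X_pow, qh_mul_qh, qh_mul_qh,
          qh_mul_qh]
        congr 1
        push_cast
        ring
      · rw [descentFactor_of_gt h, if_neg (not_lt.2 h.le), atq_one, mul_one, qh_mul_qh, qh_mul_qh]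
        congr 1
        ring
    · rfl

open Classical in
-- Among the z with sz in W_c, only z = sx reaches x, which gives L_{sx,v}; the remaining z reach x
-- through D_{x,sz}.
theorem twCoord_proj_klGen_mul_cw (hX : ProjectsKLToIC cs) {i : B} {x : W} (v : W)
    (hx : IsFC cs x) :
    twCoord hX x (proj cs (klGen M i) * cw cs v) =
      Lval cs (cs.simple i * x) v + qh (2 * descentIndicator cs i x - 1) * Lval cs x v +
        ∑ z ∈ (low cs v).filter fun z => ¬ IsFC cs (cs.simple i * z),
          dNorm cs x (cs.simple i * z) * Lval cs z v := by
  have h1 : ∀ z ∈ low cs v,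
      twCoord hX x (proj cs (klGen M i) * ((qh (-(cs.length z : ℤ)) * Lval cs z v) • tw cs z)) =
        dNorm cs x (cs.simple i * z) * Lval cs z v +
          if z = x then qh (2 * descentIndicator cs i x - 1) * Lval cs x v else 0 := by
    intro z _
    by_cases hz : IsFC cs z
    · rw [mul_smul_comm, mul_comm (qh _), ← smul_smul, map_smul,
        twCoord_proj_klGen_mul_tw hX hx hz, smul_eq_mul, mul_add, mul_comm (Lval cs z v)]
      congr 1
      split_ifs with h
      · rw [h, mul_comm]
      · rw [mul_zero]
    · rw [Lval_eq_zero hX fun h => hz h.1, mul_zero, zero_smul, mul_zero, map_zero, mul_zero,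
        if_neg, add_zero]
      rintro rfl
      exact hz hx
  rw [cw_eq_sum hX, Finset.mul_sum, map_sum, Finset.sum_congr rfl h1, Finset.sum_add_distrib,
    Finset.sum_ite_eq', ← Finset.sum_filter_add_sum_filter_not _
      (fun z => IsFC cs (cs.simple i * z))]
  have h2 : ∑ z ∈ (low cs v).filter (fun z => IsFC cs (cs.simple i * z)),
      dNorm cs x (cs.simple i * z) * Lval cs z v = Lval cs (cs.simple i * x) v := by
    rw [Finset.sum_eq_single (cs.simple i * x)]
    · by_cases hv : cs.simple i * x ∈ (low cs v).filter (fun z => IsFC cs (cs.simple i * z))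
      · rw [simple_mul_simple_cancel_left, dNorm_of_isFC hX hx hx, if_pos rfl, one_mul]
      · rw [Lval_eq_zero hX, mul_zero]
        rintro ⟨-, -, h⟩
        exact hv (Finset.mem_filter.2 ⟨mem_low.2 h, by simpa using hx⟩)
    · intro z hz hne
      rw [dNorm_of_isFC hX hx (Finset.mem_filter.1 hz).2, if_neg, zero_mul]
      rintro rfl
      simp at hne
    · intro hv
      rw [Lval_eq_zero hX, mul_zero]
      rintro ⟨-, -, h⟩
      exact hv (Finset.mem_filter.2 ⟨mem_low.2 h, by simpa using hx⟩)
  have h3 : (if x ∈ low cs v then qh (2 * descentIndicator cs i x - 1) * Lval cs x v else 0) =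
      qh (2 * descentIndicator cs i x - 1) * Lval cs x v := by
    split_ifs with h
    · rfl
    · rw [Lval_eq_zero hX fun h' => h (mem_low.2 h'.2.2), mul_zero]
  rw [h2, h3]
  ring

/-- The coordinates of e in the basis c_w are bar invariant. At a longest x in the support, the
c-coordinate equals the normalized t-coordinate, so it has only negative powers and must be zero. -/
theorem eq_zero_of_bar_eq_self (hX : ProjectsKLToIC cs) {ι : TL cs →+* TL cs}
    (hι : IsBar (tw cs) ι) (hc : ∀ w, IsFC cs w → ι (cw cs w) = cw cs w) {e : TL cs}
    (he : ι e = e) (hdeg : ∀ x, IsFC cs x → twCoord hX x e ∈ degLE (-1)) : e = 0 := by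
  have hsum : e = ∑ w ∈ ((cwBasis hX).repr e).support, (cwBasis hX).repr e w • cw cs w.1 := by
    conv_lhs => rw [← (cwBasis hX).linearCombination_repr e, Finsupp.linearCombination_apply,
      Finsupp.sum]
    simp only [cwBasis_apply]
  have hinv : ∀ w, LaurentPolynomial.invert ((cwBasis hX).repr e w) = (cwBasis hX).repr e w := by
    intro w
    have h1 : e = ∑ w ∈ ((cwBasis hX).repr e).support,
        LaurentPolynomial.invert ((cwBasis hX).repr e w) • cwBasis hX w := by
      conv_lhs => rw [← he, hsum, map_sum]
      refine Finset.sum_congr rfl fun w _ => ?_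
      rw [bar_smul hι, hc _ w.2, cwBasis_apply]
    conv_rhs => rw [h1]
    rw [map_sum, Finsupp.finsetSum_apply]
    simp only [map_smul, Module.Basis.repr_self, Finsupp.smul_apply]
    classical
    simp only [Finsupp.single_apply, smul_eq_mul, mul_ite, mul_one, mul_zero]
    rw [Finset.sum_ite_eq']
    split_ifs with h
    · rfl
    · rw [Finsupp.notMem_support_iff.1 h, map_zero]
  by_contra hne
  have hsupp : ((cwBasis hX).repr e).support.Nonempty := by
    rw [Finsupp.support_nonempty_iff]
    exact fun h => hne ((cwBasis hX).repr.map_eq_zero_iff.1 h)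
  obtain ⟨x, hx, hmax⟩ := Finset.exists_max_image _ (fun w => cs.length w.1) hsupp
  have hcoord : twCoord hX x.1 e = (cwBasis hX).repr e x := by
    conv_lhs => rw [hsum, map_sum]
    rw [Finset.sum_eq_single x]
    · rw [map_smul, twCoord_cw hX _ x.2, Lval_self hX x.2, smul_eq_mul, mul_one]
    · intro w hw hwx
      rw [map_smul, twCoord_cw hX _ x.2, Lval_eq_zero hX, smul_zero]
      rintro ⟨-, -, hle⟩
      have h1 := hle.length_lt fun h => hwx (Subtype.ext h.symm)
      have h2 := hmax w hw
      omega
    · exact fun h => absurd hx h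
  have h0 := eq_zero_of_invert_eq_self (hcoord ▸ hdeg x.1 x.2) (hinv x)
  exact Finsupp.mem_support_iff.1 hx h0

theorem cw_eq_zero (hX : ProjectsKLToIC cs) {z : W} (hz : ¬ IsFC cs z) : cw cs z = 0 := by
  rw [cw_eq_sum hX]
  refine Finset.sum_eq_zero fun x _ => ?_
  rw [Lval_eq_zero hX fun h => hz h.2.1, mul_zero, zero_smul]

/-- The difference of the two sides of the formula for `c_s c_{sw}`. -/
def cwDefect (cs : CoxeterSystem M W) (i : B) (w : W) : TL cs :=
  proj cs (klGen M i) * cw cs (cs.simple i * w) +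
    -- The z outside W_c may stay in the sum, since c_z = 0 for them.
    (∑ z ∈ descentsBelow cs i (cs.simple i * w), (-(mu cs z (cs.simple i * w)) : A) • cw cs z +
      (-1 : A) • cw cs w)

theorem twCoord_cwDefect (hX : ProjectsKLToIC cs) {i : B} {x : W} (w : W) (hx : IsFC cs x) :
    twCoord hX x (cwDefect cs i w) = twCoord hX x (proj cs (klGen M i) * cw cs (cs.simple i * w)) +
      (∑ z ∈ descentsBelow cs i (cs.simple i * w), -(mu cs z (cs.simple i * w) • Lval cs x z) +
        -Lval cs x w) := by
  rw [cwDefect, map_add, map_add, map_sum, map_smul, twCoord_cw hX _ hx, smul_eq_mul, neg_one_mul]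
  congr 2
  refine Finset.sum_congr rfl fun z _ => ?_
  rw [map_smul, twCoord_cw hX _ hx, smul_eq_mul, zsmul_eq_mul, neg_mul]

theorem twCoord_cwDefect_mem_degLE (hX : ProjectsKLToIC cs) {i : B} {x w : W} (hx : IsFC cs x)
    (hw : IsFC cs w) (hsw : cs.length (cs.simple i * w) < cs.length w) :
    twCoord hX x (cwDefect cs i w) ∈ degLE (-1) := by
  classical
  have hv := hw.simple_mul hsw
  have hD : ∑ z ∈ (low cs (cs.simple i * w)).filter fun z => ¬ IsFC cs (cs.simple i * z),
      dNorm cs x (cs.simple i * z) * Lval cs z (cs.simple i * w) ∈ degLE (-1) := by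
    refine (degLE (-1)).sum_mem fun z hz => ?_
    have hne : x ≠ cs.simple i * z := by
      rintro rfl
      exact (Finset.mem_filter.1 hz).2 hx
    exact mul_mem_degLE (dNorm_mem_degLE hX hx hne) (Lval_mem_degLE_zero cs _ _)
  have hterm : ∀ z, x ≠ z → -(mu cs z (cs.simple i * w) • Lval cs x z) ∈ degLE (-1) := fun z hz =>
    (degLE (-1)).neg_mem ((degLE (-1)).zsmul_mem (Lval_mem_degLE hX hz) _)
  rw [twCoord_cwDefect hX w hx, twCoord_proj_klGen_mul_cw hX _ hx, add_right_comm]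
  refine (degLE (-1)).add_mem ?_ hD
  -- At x = w the constants L_{sw,sw} = 1 and L_{w,w} = 1 cancel, and all other terms vanish by
  -- length.
  by_cases hxw : x = w
  · subst hxw
    have hnot : ∀ z, BruhatLE cs z (cs.simple i * x) → Lval cs x z = 0 := by
      intro z hz
      refine Lval_eq_zero hX fun h => ?_
      have h1 := h.2.2.length_le
      have h2 := hz.length_le
      omega
    rw [Lval_self hX hv, Lval_self hX hx, hnot _ (.refl _), mul_zero, add_zero,
      Finset.sum_eq_zero, zero_add, add_neg_cancel]
    · exact (degLE (-1)).zero_mem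
    · intro z hz
      rw [hnot z (mem_descentsBelow.1 hz).1, smul_zero, neg_zero]
  have hsx : cs.simple i * x ≠ cs.simple i * w := fun h => hxw (mul_left_cancel h)
  suffices h : qh (2 * descentIndicator cs i x - 1) * Lval cs x (cs.simple i * w) +
      ∑ z ∈ descentsBelow cs i (cs.simple i * w), -(mu cs z (cs.simple i * w) • Lval cs x z) ∈
        degLE (-1) by
    rw [add_assoc, ← add_assoc (qh _ * _)]
    exact (degLE (-1)).add_mem (Lval_mem_degLE hX hsx)
      ((degLE (-1)).add_mem h ((degLE (-1)).neg_mem (Lval_mem_degLE hX hxw)))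
  rw [descentIndicator]
  simp only [bruhatLT_simple_mul_iff]
  rcases lt_or_gt_of_ne (cs.length_simple_mul_ne x i) with h | h
  · rw [if_pos h]
    by_cases hle : BruhatLE cs x (cs.simple i * w)
    · have hxv : x ≠ cs.simple i * w := by
        intro he
        rw [he, simple_mul_simple_cancel_left] at h
        omega
      -- The factor q^{1/2} raises L_{x,sw} to constant term μ(x,sw), which the summand z = x
      -- cancels.
      rw [← Finset.add_sum_erase _ _ (mem_descentsBelow.2 ⟨hle, h⟩), Lval_self hX hx, ← add_assoc]
      refine (degLE (-1)).add_mem ?_ ((degLE (-1)).sum_mem fun z hz =>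
        hterm z (Finset.ne_of_mem_erase hz).symm)
      have h1 := qh_mul_mem_degLE (m := 1) (Lval_sub_mem_degLE hX hx hv hxv)
      rw [mul_sub, mul_smul_comm, qh_mul_qh, add_neg_cancel, qh_zero] at h1
      rw [← sub_eq_add_neg]
      exact h1
    · rw [Lval_eq_zero hX fun h' => hle h'.2.2, mul_zero, zero_add]
      refine (degLE (-1)).sum_mem fun z hz => hterm z ?_
      rintro rfl
      exact hle (mem_descentsBelow.1 hz).1
  · rw [if_neg (not_lt.2 h.le), mul_zero, zero_sub]
    have h1 := qh_mul_mem_degLE (m := -1) (Lval_mem_degLE_zero cs x (cs.simple i * w))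
    rw [add_zero] at h1
    refine (degLE (-1)).add_mem h1 ((degLE (-1)).sum_mem fun z hz => hterm z ?_)
    rintro rfl
    have := (mem_descentsBelow.1 hz).2
    omega

theorem cwDefect_eq_zero (hX : ProjectsKLToIC cs) {i : B} {w : W} (hw : IsFC cs w)
    (hsw : cs.length (cs.simple i * w) < cs.length w) : cwDefect cs i w = 0 := by
  obtain ⟨ι, hι, hc⟩ := (isICFamily_icPoly hX).2.2.2.1
  have hc' : ∀ z, ι (cw cs z) = cw cs z := by
    intro z
    by_cases hz : IsFC cs z
    · exact hc z hz
    · rw [cw_eq_zero hX hz, map_zero]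
  refine eq_zero_of_bar_eq_self hX hι hc ?_ fun x hx => twCoord_cwDefect_mem_degLE hX hx hw hsw
  rw [cwDefect, map_add, map_add, map_mul, bar_proj_klGen hι, hc', map_sum, bar_smul hι, hc',
    map_neg, map_one]
  congr 2
  refine Finset.sum_congr rfl fun z _ => ?_
  rw [bar_smul hι, hc', map_neg, map_intCast]

/-- Nonzero L_{x,z} forces z in W_c and x ≤ z, and then sz < z gives sx ≤ z by lifting; the interval
condition thus drops only zero terms. -/
theorem finsum_mem_interval_eq_sum (hX : ProjectsKLToIC cs) (i : B) (x v : W) :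
    ∑ᶠ z ∈ {z : W | z ∈ intervalFC cs (cs.simple i * x) v ∧ BruhatLT cs (cs.simple i * z) z},
      mu cs z v • Lval cs x z = ∑ z ∈ descentsBelow cs i v, mu cs z v • Lval cs x z := by
  have hf : {z : W | z ∈ intervalFC cs (cs.simple i * x) v ∧
      BruhatLT cs (cs.simple i * z) z}.Finite :=
    (finite_setOf_bruhatLE v).subset fun z hz => hz.1.2.2
  rw [finsum_mem_eq_finite_toFinset_sum _ hf]
  refine Finset.sum_subset (fun z hz => ?_) fun z hz hz' => ?_
  · rw [Set.Finite.mem_toFinset] at hz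
    exact mem_descentsBelow.2 ⟨hz.1.2.2, bruhatLT_simple_mul_iff.1 hz.2⟩
  · rw [mem_descentsBelow] at hz
    rw [Lval_eq_zero hX, smul_zero]
    rintro ⟨-, h2, h3⟩
    exact hz' ((Set.Finite.mem_toFinset _).2
      ⟨⟨h2, h3.simple_mul_left hz.2, hz.1⟩, bruhatLT_simple_mul_iff.2 hz.2⟩)

open Classical in
theorem finsum_mem_dPoly_eq_sum (hX : ProjectsKLToIC cs) {i : B} (x : W) {w : W}
    (hsw : cs.length (cs.simple i * w) < cs.length w) :
    qh (-1) * (∑ᶠ z ∈ {z : W | IsFC cs z ∧ ¬ IsFC cs (cs.simple i * z) ∧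
        BruhatLE cs x (cs.simple i * z) ∧ BruhatLE cs z w},
      qh ((cs.length x : ℤ) - cs.length z) * atq (dPoly cs x (cs.simple i * z)) *
        Lval cs z (cs.simple i * w)) =
      ∑ z ∈ (low cs (cs.simple i * w)).filter fun z => ¬ IsFC cs (cs.simple i * z),
        dNorm cs x (cs.simple i * z) * Lval cs z (cs.simple i * w) := by
  have hf : {z : W | IsFC cs z ∧ ¬ IsFC cs (cs.simple i * z) ∧
      BruhatLE cs x (cs.simple i * z) ∧ BruhatLE cs z w}.Finite :=
    (finite_setOf_bruhatLE w).subset fun z hz => hz.2.2.2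
  rw [finsum_mem_eq_finite_toFinset_sum _ hf, Finset.mul_sum]
  have hterm : ∀ z ∈ hf.toFinset, qh (-1) * (qh ((cs.length x : ℤ) - cs.length z) *
      atq (dPoly cs x (cs.simple i * z)) * Lval cs z (cs.simple i * w)) =
      dNorm cs x (cs.simple i * z) * Lval cs z (cs.simple i * w) := by
    intro z hz
    obtain ⟨hz1, hz2, -⟩ := (Set.Finite.mem_toFinset _).1 hz
    -- W_c is closed under left descents, so sz > z here, and q^{-1/2} turns the normalization by
    -- ℓ(z) into that by ℓ(sz).
    have hl : cs.length (cs.simple i * z) = cs.length z + 1 :=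
      (cs.length_simple_mul z i).resolve_right fun h => hz2 (hz1.simple_mul (by omega))
    rw [← mul_assoc, ← mul_assoc, qh_mul_qh, dNorm, hl]
    congr 3
    push_cast
    ring
  rw [Finset.sum_congr rfl hterm]
  have hvw : BruhatLE cs (cs.simple i * w) w := simple_mul_bruhatLE hsw
  have h1 : hf.toFinset ⊆ (low cs w).filter fun z => ¬ IsFC cs (cs.simple i * z) := by
    intro z hz
    obtain ⟨-, h2, -, h4⟩ := (Set.Finite.mem_toFinset _).1 hz
    exact Finset.mem_filter.2 ⟨mem_low.2 h4, h2⟩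
  have h2 : ((low cs (cs.simple i * w)).filter fun z => ¬ IsFC cs (cs.simple i * z)) ⊆
      (low cs w).filter fun z => ¬ IsFC cs (cs.simple i * z) := by
    refine Finset.filter_subset_filter _ fun z hz => ?_
    exact mem_low.2 ((mem_low.1 hz).trans hvw)
  -- Both sums extend to all z ≤ w with sz outside W_c: the extra terms have D_{x,sz} = 0 or
  -- L_{z,sw} = 0.
  rw [Finset.sum_subset h1, Finset.sum_subset h2]
  · intro z hz hz'
    rw [Lval_eq_zero hX, mul_zero]
    exact fun h => hz' (Finset.mem_filter.2 ⟨mem_low.2 h.2.2, (Finset.mem_filter.1 hz).2⟩)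
  · intro z hz hz'
    obtain ⟨hzw, hsz⟩ := Finset.mem_filter.1 hz
    by_cases hz1 : IsFC cs z
    · have : dPoly cs x (cs.simple i * z) = 0 := (isDFamily_dPoly hX).1 _ _ fun h =>
        hz' ((Set.Finite.mem_toFinset _).2 ⟨hz1, hsz, h.2, mem_low.1 hzw⟩)
      rw [dNorm, this, atq_zero, mul_zero, zero_mul]
    · rw [Lval_eq_zero hX fun h => hz1 h.1, mul_zero]

end Recursion

end GenTL

end

theorem mainTheorem8 {B W : Type*} [Group W] {M : CoxeterMatrix B} (cs : CoxeterSystem M W)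
    (hX : GenTL.ProjectsKLToIC cs) (i : B) (x w : W)
    (hx : GenTL.IsFC cs x) (hw : GenTL.IsFC cs w)
    (hsx : GenTL.IsFC cs (cs.simple i * x))
    (hsw : GenTL.BruhatLT cs (cs.simple i * w) w) :
    GenTL.Lval cs x w =
      GenTL.Lval cs (cs.simple i * x) (cs.simple i * w)
      + GenTL.qh (2 * GenTL.descentIndicator cs i x - 1)
          * GenTL.Lval cs x (cs.simple i * w)
      - (∑ᶠ z ∈ {z : W | z ∈ GenTL.intervalFC cs (cs.simple i * x) (cs.simple i * w) ∧
            GenTL.BruhatLT cs (cs.simple i * z) z},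
          GenTL.mu cs z (cs.simple i * w) • GenTL.Lval cs x z)
      + GenTL.qh (-1) *
          (∑ᶠ z ∈ {z : W | GenTL.IsFC cs z ∧ ¬ GenTL.IsFC cs (cs.simple i * z) ∧
              GenTL.BruhatLE cs x (cs.simple i * z) ∧ GenTL.BruhatLE cs z w},
            GenTL.qh ((cs.length x : ℤ) - cs.length z)
              * GenTL.atq (GenTL.dPoly cs x (cs.simple i * z))
              * GenTL.Lval cs z (cs.simple i * w)) := by
  have hl := GenTL.bruhatLT_simple_mul_iff.1 hsw
  have h := congrArg (GenTL.twCoord hX x) (GenTL.cwDefect_eq_zero hX hw hl)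
  rw [GenTL.twCoord_cwDefect hX w hx, GenTL.twCoord_proj_klGen_mul_cw hX _ hx, map_zero,
    Finset.sum_neg_distrib] at h
  rw [GenTL.finsum_mem_interval_eq_sum hX, GenTL.finsum_mem_dPoly_eq_sum hX x hl]
  linear_combination -h
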